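/- Let $\mathbb T=\mathbb R/\mathbb Z$ with its normalized Haar (Lebesgue) measure $d\theta$, let $\omega\in\mathbb R\setminus\mathbb Q$ and $\gamma>0$. For $f:\mathbb T\to\mathbb R$ let $J_f$ be its set of discontinuities. We write $f\in PL_\gamma(\mathbb T)$ if $J_f$ is finite and $$\|f\|_{PL_\gamma}=\sup_{t\in\mathbb T}|f(t)|+\sup_{h>0}\ \sup_{t:\,\mathrm{dist}(t,J_f)>h}\frac{|f(t+h)-f(t)|}{h^\gamma}<\infty$$ (with $\mathrm{dist}(t,\emptyset)=\infty$). For $z\in\mathbb C$, $\theta\in\mathbb T$ put $$A(\theta,z)=\begin{pmatrix} z-f(\theta)&-1\\ 1&0\end{pmatrix},\qquad A_0(\theta,z)=I,\qquad A_k(\theta,z)=A(\theta+(k-1)\omega,z)\cdots A(\theta+\omega,z)A(\theta,z)\quad(k\ge1),$$ and $A_{k}(\theta,z)=\big(A_{-k}(\theta+k\omega,z)\big)^{-1}$ for $k<0$. With $\|\cdot\|$ the operator norm on $\mathbb C^2$, the Lyapunov exponent is $$\mathcal L(z)=\lim_{k\to\infty}\frac1k\int_{\mathbb T}\ln\|A_k(\theta,z)\|\,d\theta=\inf_{k\ge1}\frac1k\int_{\mathbb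 T}\ln\|A_k(\theta,z)\|\,d\theta .$$ For $\delta\ge1$, $0<\zeta\le1$, $E\in\mathbb C$ and $T>0$ let $$\Phi_{\zeta,\delta}(E,T)=\inf_{|z-E|\le T^{-\zeta},\ \theta\in\mathbb T}\ \min\left\{\frac{\max_{1\le j\le T^\zeta}\|A_j(\theta,z)\|^2}{T^\delta},\ \frac{\max_{1\le j\le T^\zeta}\|A_{-j}(\theta,z)\|^2}{T^\delta}\right\}.$$ Let $q_n$ be the denominators of the continued fraction approximants of $\omega$; $\omega$ is called Diophantine if for some $\kappa>0$ one has $q_{n+1}<q_n^{1+\kappa}$ for all large $n$. **Proposition.** Let $f\in PL_\gamma(\mathbb T)$, let $\chi>0$, and suppose $\mathcal L(E)>\chi$ for all $E$ in a Borel set $U\subset\mathbb R$. Then for any $\delta\ge1$ and $0<\zeta\le1$ there are $c>0$ and a sequence $T_n\to\infty$ such that: 1. for every $E\in U$ there is $n_E$ such that $\Phi_{\zeta,\delta}(E,T_n)>c$ for all $n>n_E$; 2. if $\omega$ is Diophantine, then for every $E\in U$ there is $T_E<\infty$ such that $\Phi_{\zeta,\delta}(E,T)>c$ for all $T>T_E$;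 3. if $U$ is compact and $\mathcal L$ is continuous on $U$, then $n_E$ in (1) can be chosen independent of $E\in U$, and, if in addition $\omega$ is Diophantine, $T_E$ in (2) can be chosen independent of $E\in U$. -/

import Mathlib

namespace QPCocycle

open MeasureTheory Filter

open scoped ENNReal Matrix.Norms.L2Operator

/-- The set `J_f` of discontinuities of a function on the circle `𝕋 = ℝ/ℤ`. -/
def discontinuities (f : UnitAddCircle → ℝ) : Set UnitAddCircle :=
  {t | ¬ ContinuousAt f t}

/-- `‖f‖_{PL_γ} = ‖f‖_∞ + sup_{h > 0} sup_{dist(t, J_f) > h} |f(t+h) - f(t)| / h^γ`, with values in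
`[0, ∞]`.  Here `‖f‖_∞` is the supremum over all points of the circle, and the distance to the
empty set is `∞`. -/
noncomputable def plNorm (γ : ℝ) (f : UnitAddCircle → ℝ) : ℝ≥0∞ :=
  (⨆ t : UnitAddCircle, ENNReal.ofReal |f t|) +
    ⨆ (h : ℝ) (_ : 0 < h) (t : UnitAddCircle)
      (_ : ENNReal.ofReal h < Metric.infEDist t (discontinuities f)),
      ENNReal.ofReal (|f (t + (h : UnitAddCircle)) - f t| / h ^ γ)

/-- The space `PL_γ(𝕋)` of piecewise `γ`-Lipschitz functions: finitely many discontinuities and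
finite `PL_γ` norm. -/
def PL (γ : ℝ) : Set (UnitAddCircle → ℝ) :=
  {f | (discontinuities f).Finite ∧ plNorm γ f < ⊤}

/-- The one-step transfer matrix `A^{f,z}(θ)`. -/
def transferMatrix (f : UnitAddCircle → ℝ) (z : ℂ) (θ : UnitAddCircle) :
    Matrix (Fin 2) (Fin 2) ℂ :=
  !![z - (f θ : ℂ), -1; 1, 0]

/-- The forward iterates `A_n(θ) = A(θ + (n-1)ω) ⋯ A(θ + ω) A(θ)`, `A_0(θ) = 1`. -/
def forwardCocycle (ω : ℝ) (f : UnitAddCircle → ℝ) (z : ℂ) :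
    ℕ → UnitAddCircle → Matrix (Fin 2) (Fin 2) ℂ
  | 0, _ => 1
  | n + 1, θ => transferMatrix f z (θ + n • (ω : UnitAddCircle)) * forwardCocycle ω f z n θ

/-- The iterates `A_k(θ)` for all `k ∈ ℤ`; for `k < 0`, `A_k(θ) = (A_{-k}(θ + kω))⁻¹`.  Thus a
solution of `u(n+1) + u(n-1) + f(θ + nω) u(n) = z u(n)` satisfies
`(u(k), u(k-1)) = A_k(θ) (u(0), u(-1))` for every `k`. -/
noncomputable def cocycle (ω : ℝ) (f : UnitAddCircle → ℝ) (z : ℂ) (k : ℤ) (θ : UnitAddCircle) :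
    Matrix (Fin 2) (Fin 2) ℂ :=
  if 0 ≤ k then forwardCocycle ω f z k.toNat θ
  else (forwardCocycle ω f z (-k).toNat (θ + k • (ω : UnitAddCircle)))⁻¹

/-- The Lyapunov exponent `𝓛(z) = inf_{k ≥ 1} (1/k) ∫ ln ‖A_k(θ)‖ dθ`, where `‖·‖` is the operator
norm for the Euclidean norm on `ℂ²` and `dθ` is the normalized Haar measure of the circle. -/
noncomputable def lyapunov (ω : ℝ) (f : UnitAddCircle → ℝ) (z : ℂ) : ℝ :=
  ⨅ k : {k : ℕ // 1 ≤ k},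
    (1 / (k : ℝ)) * ∫ θ : UnitAddCircle, Real.log ‖cocycle ω f z ((k : ℕ) : ℤ) θ‖

/-- The Diophantine condition `q_{n+1} < q_n^{1+κ}` for some `κ > 0` and all large `n`, where `q_n`
are the denominators of the continued fraction approximants of `ω`. -/
def Diophantine (ω : ℝ) : Prop :=
  ∃ κ : ℝ, 0 < κ ∧ ∀ᶠ n : ℕ in atTop,
    (GenContFract.of ω).dens (n + 1) < (GenContFract.of ω).dens n ^ (1 + κ)

/-- The quantity `Φ_{ζ,δ}(E,T)`: the infimum over `|z - E| ≤ T^{-ζ}` and all `θ` of the smaller of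
`max_{1 ≤ j ≤ T^ζ} ‖A_j(θ,z)‖² / T^δ` and `max_{1 ≤ j ≤ T^ζ} ‖A_{-j}(θ,z)‖² / T^δ`. -/
noncomputable def Phi (ω : ℝ) (f : UnitAddCircle → ℝ) (ζ δ : ℝ) (E : ℂ) (T : ℝ) : ℝ :=
  ⨅ p : {z : ℂ // ‖z - E‖ ≤ T ^ (-ζ)} × UnitAddCircle,
    min
      ((⨆ j : {j : ℕ // 1 ≤ j ∧ (j : ℝ) ≤ T ^ ζ},
        ‖cocycle ω f p.1 ((j : ℕ) : ℤ) p.2‖ ^ 2) / T ^ δ)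
      ((⨆ j : {j : ℕ // 1 ≤ j ∧ (j : ℝ) ≤ T ^ ζ},
        ‖cocycle ω f p.1 (-((j : ℕ) : ℤ)) p.2‖ ^ 2) / T ^ δ)

end QPCocycle

namespace QPCocycle

open MeasureTheory Filter

open scoped ENNReal Matrix.Norms.L2Operator Topology

/-! ### Norms of `2 × 2` matrices of determinant one -/

/-! All iterates have determinant one, so inverses are controlled by norms. If `A_k(θ+nω) =
A_{k+n}(θ) A_n(θ)⁻¹` has norm at least a multiple of `T^δ`, then `A_{k+n}(θ)` or `A_n(θ)` has
squared norm at least `T^δ`. It therefore suffices to find an interval on which `A_k` is this large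
for all `z` within `T^(-ζ)` of `E`, and which every orbit enters soon enough (`one_le_Phi`). For a
convergent `p/q`, orbits of length `q` meet every interval of length `3/q`
(`exists_lt_add_smul_eq`).

The interval comes from the exponent. Submultiplicativity and unique ergodicity give `‖A_k‖ ≤ C
e^{(𝓛(E)+ε)k}` uniformly in `θ` and in `z` near `E` (`exists_norm_forwardCocycle_le`); the jumps of
`f` do no harm, because `ln ‖A_N‖` has continuous majorants with nearly the same mean. As `ln ‖A_k‖`
has mean at least `k 𝓛(E)`, the points where it is at least `(𝓛(E)-ε)k` cannot all lie in a set of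
measure `1/4`, so one of them has an orbit staying `3/q` away from the jumps (`exists_far_norm_ge`).
Moving that point by less than `3/q`, and `E` by `T^(-ζ)`, changes `A_k` by a relative error of
about `k e^{2εk} (T^(-ζ) + q^(-γ))`, which is small when `k` is of order `ln T` and `ε` is small
(`exists_interval_norm_ge`).

This needs a denominator with `2q ≤ T^ζ ≤ 2q^a`: one exists along `T_n = (2q_n)^(1/ζ)`, and for
every large `T` if `ω` is Diophantine. The energy enters the constants only through the upper bound,
which is uniform on compact sets where `𝓛` is continuous; pointwise statements are the case of a
singleton. -/

theorem norm_entry_le (A : Matrix (Fin 2) (Fin 2) ℂ) (i j : Fin 2) : ‖A i j‖ ≤ ‖A‖ := by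
  have h := Matrix.l2_opNorm_mulVec A (EuclideanSpace.single j (1 : ℂ))
  rw [PiLp.norm_single, norm_one, mul_one] at h
  refine le_trans ?_ h
  refine le_trans (le_of_eq ?_) (PiLp.norm_apply_le _ i)
  simp

/-- Cayley–Hamilton: `A⁻¹ = tr A - A`, and each entry is at most the norm. The sharp constant is 1,
but 3 is enough here. -/
theorem norm_inv_le {A : Matrix (Fin 2) (Fin 2) ℂ} (h : A.det = 1) : ‖A⁻¹‖ ≤ 3 * ‖A‖ := by
  have e : A⁻¹ = (A 0 0 + A 1 1) • (1 : Matrix (Fin 2) (Fin 2) ℂ) - A := by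
    rw [Matrix.inv_def, h, Matrix.adjugate_fin_two]
    ext i j
    fin_cases i <;> fin_cases j <;> simp
  rw [e]
  refine (norm_sub_le _ _).trans ?_
  rw [norm_smul, CStarRing.norm_one, mul_one]
  linarith [norm_add_le (A 0 0) (A 1 1), norm_entry_le A 0 0, norm_entry_le A 1 1]

/-- The lossy factor 3 is removed by passing to powers: `1 ≤ 3 ‖A‖^(2n)` for all `n` is impossible
if `‖A‖ < 1`. -/
theorem one_le_norm_of_det_eq_one {A : Matrix (Fin 2) (Fin 2) ℂ} (h : A.det = 1) : 1 ≤ ‖A‖ := by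
  by_contra! hlt
  have key : ∀ n : ℕ, 1 ≤ 3 * (‖A‖ ^ n * ‖A‖ ^ n) := fun n => by
    have hd : (A ^ n).det = 1 := by rw [Matrix.det_pow, h, one_pow]
    have h1 : ‖(A ^ n)⁻¹ * A ^ n‖ = 1 := by
      rw [Matrix.nonsing_inv_mul _ (by rw [hd]; exact isUnit_one), CStarRing.norm_one]
    calc (1 : ℝ) = ‖(A ^ n)⁻¹ * A ^ n‖ := h1.symm
      _ ≤ ‖(A ^ n)⁻¹‖ * ‖A ^ n‖ := norm_mul_le _ _
      _ ≤ 3 * ‖A ^ n‖ * ‖A ^ n‖ := by gcongr; exact norm_inv_le hd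
      _ = 3 * (‖A ^ n‖ * ‖A ^ n‖) := by ring
      _ ≤ _ := by gcongr <;> exact norm_pow_le _ _
  have ht := tendsto_pow_atTop_nhds_zero_of_lt_one (norm_nonneg A) hlt
  have ht2 := (ht.mul ht).const_mul 3
  have := ge_of_tendsto' ht2 key
  norm_num at this

/-! ### The cocycle -/

section

variable (ω : ℝ) (f : UnitAddCircle → ℝ)

theorem transferMatrix_det (z : ℂ) (θ : UnitAddCircle) : (transferMatrix f z θ).det = 1 := by
  simp [transferMatrix, Matrix.det_fin_two]

theorem forwardCocycle_det (z : ℂ) (n : ℕ) (θ : UnitAddCircle) :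
    (forwardCocycle ω f z n θ).det = 1 := by
  induction n with
  | zero => simp [forwardCocycle]
  | succ n ih => rw [forwardCocycle, Matrix.det_mul, ih, transferMatrix_det, one_mul]

theorem one_le_norm_forwardCocycle (z : ℂ) (n : ℕ) (θ : UnitAddCircle) :
    1 ≤ ‖forwardCocycle ω f z n θ‖ :=
  one_le_norm_of_det_eq_one (forwardCocycle_det ω f z n θ)

theorem forwardCocycle_add (z : ℂ) (m n : ℕ) (θ : UnitAddCircle) :
    forwardCocycle ω f z (m + n) θ =
      forwardCocycle ω f z m (θ + n • (ω : UnitAddCircle)) * forwardCocycle ω f z n θ := by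
  induction m with
  | zero => simp [forwardCocycle]
  | succ m ih =>
    rw [Nat.succ_add, forwardCocycle, ih, forwardCocycle, ← mul_assoc, add_comm m n, add_smul,
      add_assoc]

theorem norm_transferMatrix_sub (z z' : ℂ) (θ θ' : UnitAddCircle) :
    ‖transferMatrix f z θ - transferMatrix f z' θ'‖ ≤ ‖z - z'‖ + |f θ - f θ'| := by
  have e : transferMatrix f z θ - transferMatrix f z' θ' =
      Matrix.diagonal ![(z - z') - ((f θ - f θ' : ℝ) : ℂ), 0] := by
    ext i j
    fin_cases i <;> fin_cases j <;> simp [transferMatrix]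
    ring
  rw [e, Matrix.l2_opNorm_diagonal]
  refine (pi_norm_le_iff_of_nonneg (by positivity)).2 fun i => ?_
  fin_cases i
  · refine (norm_sub_le _ _).trans ?_
    rw [Complex.norm_real, Real.norm_eq_abs]
  · simp only [Fin.mk_one, Matrix.cons_val_one, Matrix.cons_val_fin_one, norm_zero]
    positivity

/-- Telescoping: the factors are exchanged one at a time, starting from the right. Bounding both
remaining products by the same exponential rate, instead of a crude power, keeps the loss small when
that rate is close to the Lyapunov exponent. -/
theorem norm_forwardCocycle_sub_le {B lam η : ℝ} (hη : 0 ≤ η) (hB : 0 ≤ B) {z z' : ℂ}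
    (hz : ∀ (j : ℕ) (t : UnitAddCircle), ‖forwardCocycle ω f z j t‖ ≤ B * Real.exp (lam * j))
    (hz' : ∀ (j : ℕ) (t : UnitAddCircle), ‖forwardCocycle ω f z' j t‖ ≤ B * Real.exp (lam * j))
    (hlam : 0 ≤ lam) (k : ℕ) (θ θ' : UnitAddCircle)
    (h : ∀ i < k, ‖z - z'‖ +
      |f (θ + i • (ω : UnitAddCircle)) - f (θ' + i • (ω : UnitAddCircle))| ≤ η) :
    ‖forwardCocycle ω f z k θ - forwardCocycle ω f z' k θ'‖ ≤
      k * (B ^ 2 * Real.exp (lam * k) * η) := by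
  -- Hybrid product: the first `i` factors use `(z', θ')`, the remaining `k - i` use `(z, θ)`.
  have key : ∀ i : ℕ, i ≤ k → ‖forwardCocycle ω f z k θ -
      forwardCocycle ω f z (k - i) (θ + i • (ω : UnitAddCircle)) * forwardCocycle ω f z' i θ'‖ ≤
      i * (B ^ 2 * Real.exp (lam * k) * η) := by
    intro i
    induction i with
    | zero => simp [forwardCocycle]
    | succ i ih =>
      intro hi
      set G := forwardCocycle ω f z (k - (i + 1)) (θ + (i + 1) • (ω : UnitAddCircle))
      set Y := forwardCocycle ω f z' i θ'
      have e1 : forwardCocycle ω f z (k - i) (θ + i • (ω : UnitAddCircle)) =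
          G * transferMatrix f z (θ + i • (ω : UnitAddCircle)) := by
        have : k - i = (k - (i + 1)) + 1 := by omega
        rw [this, forwardCocycle_add]
        simp [forwardCocycle, G, add_smul, add_assoc]
      have e2 : forwardCocycle ω f z' (i + 1) θ' =
          transferMatrix f z' (θ' + i • (ω : UnitAddCircle)) * Y := rfl
      have e3 : forwardCocycle ω f z k θ - G * forwardCocycle ω f z' (i + 1) θ' =
          (forwardCocycle ω f z k θ -
            forwardCocycle ω f z (k - i) (θ + i • (ω : UnitAddCircle)) * Y) +
          G * (transferMatrix f z (θ + i • (ω : UnitAddCircle)) -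
            transferMatrix f z' (θ' + i • (ω : UnitAddCircle))) * Y := by
        rw [e1, e2]; noncomm_ring
      rw [e3]
      refine (norm_add_le _ _).trans ?_
      have hG := hz (k - (i + 1)) (θ + (i + 1) • (ω : UnitAddCircle))
      have hY := hz' i θ'
      have hT := (norm_transferMatrix_sub f z z' (θ + i • (ω : UnitAddCircle))
        (θ' + i • (ω : UnitAddCircle))).trans (h i hi)
      have h2 : ‖G * (transferMatrix f z (θ + i • (ω : UnitAddCircle)) -
            transferMatrix f z' (θ' + i • (ω : UnitAddCircle))) * Y‖ ≤
          B ^ 2 * Real.exp (lam * k) * η := by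
        calc _ ≤ ‖G‖ * ‖transferMatrix f z (θ + i • (ω : UnitAddCircle)) -
            transferMatrix f z' (θ' + i • (ω : UnitAddCircle))‖ * ‖Y‖ :=
              (norm_mul_le _ _).trans (by gcongr; exact norm_mul_le _ _)
          _ ≤ (B * Real.exp (lam * (k - (i + 1) : ℕ))) * η * (B * Real.exp (lam * i)) := by
              gcongr
          _ = B ^ 2 * Real.exp (lam * ((k - (i + 1) : ℕ) + (i : ℕ))) * η := by
              rw [mul_add, Real.exp_add]; ring
          _ ≤ _ := by
              gcongr
              rw [← Nat.cast_add]
              exact_mod_cast (by omega : k - (i + 1) + i ≤ k)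
      push_cast
      linarith [ih (by omega)]
  have := key k le_rfl
  simpa [forwardCocycle] using this

theorem norm_cocycle_neg_le (z : ℂ) (j : ℕ) (θ : UnitAddCircle) :
    ‖forwardCocycle ω f z j (θ - j • (ω : UnitAddCircle))‖ ≤
      3 * ‖cocycle ω f z (-(j : ℤ)) θ‖ := by
  rcases Nat.eq_zero_or_pos j with rfl | hj
  · simp only [cocycle, forwardCocycle, CharP.cast_eq_zero, neg_zero, le_refl, if_true,
      Int.toNat_zero, CStarRing.norm_one]
    norm_num
  · have hd := forwardCocycle_det ω f z j (θ - j • (ω : UnitAddCircle))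
    have e : cocycle ω f z (-(j : ℤ)) θ =
        (forwardCocycle ω f z j (θ - j • (ω : UnitAddCircle)))⁻¹ := by
      rw [cocycle, if_neg (by omega)]
      simp [sub_eq_add_neg]
    rw [e]
    have h := norm_inv_le (A := (forwardCocycle ω f z j (θ - j • (ω : UnitAddCircle)))⁻¹)
      (by rw [Matrix.det_nonsing_inv, hd]; simp)
    rwa [Matrix.nonsing_inv_nonsing_inv _ (by rw [hd]; exact isUnit_one)] at h

theorem cocycle_natCast (z : ℂ) (j : ℕ) (θ : UnitAddCircle) :
    cocycle ω f z (j : ℤ) θ = forwardCocycle ω f z j θ := by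
  simp [cocycle]

/-- A large norm of one factor forces a large norm of the full product or of the other factor. -/
theorem norm_forwardCocycle_le_left (z : ℂ) (m n : ℕ) (θ : UnitAddCircle) :
    ‖forwardCocycle ω f z m (θ + n • (ω : UnitAddCircle))‖ ≤
      3 * ‖forwardCocycle ω f z (m + n) θ‖ * ‖forwardCocycle ω f z n θ‖ := by
  have hd := forwardCocycle_det ω f z n θ
  have e : forwardCocycle ω f z m (θ + n • (ω : UnitAddCircle)) =
      forwardCocycle ω f z (m + n) θ * (forwardCocycle ω f z n θ)⁻¹ := by
    rw [forwardCocycle_add, mul_assoc, Matrix.mul_nonsing_inv _ (by rw [hd]; exact isUnit_one),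
      mul_one]
  rw [e]
  refine (norm_mul_le _ _).trans ?_
  calc _ ≤ ‖forwardCocycle ω f z (m + n) θ‖ * (3 * ‖forwardCocycle ω f z n θ‖) := by
        gcongr; exact norm_inv_le hd
    _ = _ := by ring

theorem norm_forwardCocycle_le_right (z : ℂ) (m n : ℕ) (θ : UnitAddCircle) :
    ‖forwardCocycle ω f z n θ‖ ≤
      3 * ‖forwardCocycle ω f z m (θ + n • (ω : UnitAddCircle))‖ *
        ‖forwardCocycle ω f z (m + n) θ‖ := by
  have hd := forwardCocycle_det ω f z m (θ + n • (ω : UnitAddCircle))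
  have e : forwardCocycle ω f z n θ =
      (forwardCocycle ω f z m (θ + n • (ω : UnitAddCircle)))⁻¹ *
        forwardCocycle ω f z (m + n) θ := by
    rw [forwardCocycle_add, ← mul_assoc,
      Matrix.nonsing_inv_mul _ (by rw [hd]; exact isUnit_one), one_mul]
  rw [e]
  refine (norm_mul_le _ _).trans ?_
  gcongr
  exact norm_inv_le hd

end

/-! ### Continued fraction denominators and return times -/

section

open GenContFract

theorem not_terminatedAt_of_irrational {ω : ℝ} (hω : Irrational ω) (n : ℕ) :
    ¬ (GenContFract.of ω).TerminatedAt n := fun h =>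
  hω (by
    obtain ⟨q, hq⟩ := (terminates_iff_rat ω).1 ⟨n, h⟩
    exact ⟨q, hq.symm⟩)

/-- Two consecutive terms are carried along because the recurrence has order two. -/
theorem exists_int_contsAux {ω : ℝ} (hω : Irrational ω) (n : ℕ) :
    (∃ a b : ℤ, (GenContFract.of ω).contsAux n = ⟨a, b⟩) ∧
      ∃ a b : ℤ, (GenContFract.of ω).contsAux (n + 1) = ⟨a, b⟩ := by
  induction n with
  | zero =>
    exact ⟨⟨1, 0, by simp [contsAux]⟩, ⟨⌊ω⌋, 1, by simp [contsAux, GenContFract.of_h_eq_floor]⟩⟩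
  | succ n ih =>
    refine ⟨ih.2, ?_⟩
    obtain ⟨⟨a, b, h0⟩, ⟨c, d, h1⟩⟩ := ih
    obtain ⟨gp, hgp⟩ : ∃ gp, (GenContFract.of ω).s.get? n = some gp :=
      Option.ne_none_iff_exists'.1 (not_terminatedAt_of_irrational hω n)
    obtain ⟨ha, e, he⟩ := of_partNum_eq_one_and_exists_int_partDen_eq hgp
    refine ⟨e * c + a, e * d + b, ?_⟩
    rw [contsAux_recurrence hgp h0 h1, ha, he]
    push_cast
    simp

theorem tendsto_dens {ω : ℝ} (hω : Irrational ω) :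
    Tendsto (fun n => (GenContFract.of ω).dens n) atTop atTop := by
  refine tendsto_atTop_mono' _ ?_ tendsto_natCast_atTop_atTop
  filter_upwards [eventually_ge_atTop 5] with n hn
  refine le_trans ?_ (succ_nth_fib_le_of_nth_den (Or.inr (not_terminatedAt_of_irrational hω _)))
  exact_mod_cast (Nat.le_fib_self hn).trans Nat.fib_le_fib_succ

theorem exists_coprime_convergent {ω : ℝ} (hω : Irrational ω) (n : ℕ) :
    ∃ (p : ℤ) (q : ℕ), 1 ≤ q ∧ (q : ℝ) = (GenContFract.of ω).dens n ∧ IsCoprime p (q : ℤ) ∧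
      |ω - p / q| ≤ 1 / (q : ℝ) ^ 2 := by
  obtain ⟨a, b, h0⟩ := (exists_int_contsAux hω n).2
  obtain ⟨a', b', h1⟩ := (exists_int_contsAux hω (n + 1)).2
  have hn0 : (GenContFract.of ω).nums n = a := by
    rw [num_eq_conts_a, nth_cont_eq_succ_nth_contAux, h0]
  have hd0 : (GenContFract.of ω).dens n = b := by
    rw [den_eq_conts_b, nth_cont_eq_succ_nth_contAux, h0]
  have hn1 : (GenContFract.of ω).nums (n + 1) = a' := by
    rw [num_eq_conts_a, nth_cont_eq_succ_nth_contAux, h1]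
  have hd1 : (GenContFract.of ω).dens (n + 1) = b' := by
    rw [den_eq_conts_b, nth_cont_eq_succ_nth_contAux, h1]
  have hb1 : (1 : ℝ) ≤ b := by
    rw [← hd0]
    refine le_trans ?_ (succ_nth_fib_le_of_nth_den (Or.inr (not_terminatedAt_of_irrational hω _)))
    exact_mod_cast Nat.fib_pos.2 n.succ_pos
  have hb : 1 ≤ b := by exact_mod_cast hb1
  have hbb' : (b : ℝ) ≤ b' := by
    rw [← hd0, ← hd1]; exact of_den_mono
  have hdet : a * b' - b * a' = (-1) ^ (n + 1) := by
    have := SimpContFract.determinant (s := SimpContFract.of ω)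
      (not_terminatedAt_of_irrational hω n)
    change (GenContFract.of ω).nums n * (GenContFract.of ω).dens (n + 1) -
      (GenContFract.of ω).dens n * (GenContFract.of ω).nums (n + 1) = _ at this
    rw [hn0, hd0, hn1, hd1] at this
    exact_mod_cast this
  have hq : ((b.toNat : ℕ) : ℤ) = b := Int.toNat_of_nonneg (by omega)
  have hqr : ((b.toNat : ℕ) : ℝ) = b := by exact_mod_cast congrArg (Int.cast : ℤ → ℝ) hq
  refine ⟨a, b.toNat, by omega, by rw [hqr, hd0], ?_, ?_⟩
  · rw [hq]
    -- The determinant identity for consecutive convergents supplies the Bézout coefficients.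
    refine ⟨(-1) ^ (n + 1) * b', -(-1) ^ (n + 1) * a', ?_⟩
    calc _ = (-1) ^ (n + 1) * (a * b' - b * a') := by ring
      _ = ((-1) * (-1)) ^ (n + 1) := by rw [hdet, mul_pow]
      _ = 1 := by norm_num
  · have h := abs_sub_convs_le (not_terminatedAt_of_irrational hω n)
    rw [conv_eq_num_div_den, hn0, hd0, hd1] at h
    rw [hqr]
    refine h.trans ?_
    rw [sq]
    gcongr

end

/-- An orbit of length `q` of the rotation meets every interval of length `3 / q`. -/
theorem exists_lt_add_smul_eq {ω : ℝ} {p : ℤ} {q : ℕ} (hq : 1 ≤ q) (hpq : IsCoprime p (q : ℤ))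
    (hω : |ω - p / q| ≤ 1 / (q : ℝ) ^ 2) (θ θ₀ : UnitAddCircle) :
    ∃ j < q, ∃ s : ℝ, 0 < s ∧ s < 3 / q ∧
      θ + j • (ω : UnitAddCircle) = θ₀ + (s : UnitAddCircle) := by
  obtain ⟨x, hx⟩ := QuotientAddGroup.mk_surjective (θ₀ - θ)
  have hx' : (x : UnitAddCircle) = θ₀ - θ := hx
  have hqr : (0 : ℝ) < q := by exact_mod_cast hq
  -- This puts `a/q` in `[x + 1/q, x + 2/q)`, leaving a margin `1/q` on both sides for the drift
  -- `e`.
  set a : ℤ := ⌈q * x⌉ + 1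
  have ha1 : q * x + 1 ≤ a := by
    have := Int.le_ceil (q * x)
    simp only [a]; push_cast; linarith
  have ha2 : (a : ℝ) < q * x + 2 := by
    have := Int.ceil_lt_add_one (q * x)
    simp only [a]; push_cast; linarith
  obtain ⟨u, v, huv⟩ := hpq
  have hq0 : (q : ℤ) ≠ 0 := by omega
  have hj0 := Int.emod_nonneg (a * u) hq0
  -- Since `u` inverts `p` modulo `q`, the residue `j` of `a u` satisfies `j p ≡ a`.
  have hj1 := Int.emod_lt_of_pos (a * u) (by omega : (0 : ℤ) < q)
  obtain ⟨j, hj⟩ := Int.eq_ofNat_of_zero_le hj0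
  have hjq : j < q := by omega
  set b : ℤ := -(a * u / q) * p - a * v
  have hb : (j : ℤ) * p = a + b * q := by
    have h1 := Int.emod_add_mul_ediv (a * u) q
    rw [hj] at h1
    have h2 : (j : ℤ) = a * u - q * (a * u / q) := by linarith
    rw [h2]
    simp only [b]
    linear_combination a * huv
  have hbr : (j : ℝ) * p = a + b * q := by exact_mod_cast hb
  set e : ℝ := j * (ω - p / q)
  have he : |e| < 1 / q := by
    rw [abs_mul, Nat.abs_cast]
    calc (j : ℝ) * |ω - p / q| ≤ j * (1 / (q : ℝ) ^ 2) := by gcongr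
      _ < q * (1 / (q : ℝ) ^ 2) := by
        gcongr
      _ = 1 / q := by field_simp
  rw [abs_lt] at he
  have h3 : x + 1 / q ≤ a / q := by
    rw [le_div_iff₀ hqr, add_mul, one_div_mul_cancel hqr.ne']; linarith
  have h4 : (a : ℝ) / q < x + 2 / q := by
    rw [div_lt_iff₀ hqr, add_mul, div_mul_cancel₀ _ hqr.ne']; linarith
  have e3 : (3 : ℝ) / q = 2 / q + 1 / q := by ring
  refine ⟨j, hjq, a / q - x + e, by linarith, by linarith, ?_⟩
  have hs : (a : ℝ) / q - x + e = j * ω - x - b := by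
    have : (j : ℝ) * p / q = a / q + b := by
      rw [hbr]; field_simp
    simp only [e]
    linear_combination -this
  have hint : ((b : ℝ) : UnitAddCircle) = 0 := by
    have : (b : ℝ) = b • (1 : ℝ) := by simp
    rw [this, AddCircle.coe_zsmul, AddCircle.coe_period, smul_zero]
  rw [hs, AddCircle.coe_sub, AddCircle.coe_sub, hx', hint, ← nsmul_eq_mul, AddCircle.coe_nsmul]
  abel

/-! ### Uniform equidistribution of irrational rotations -/

theorem measureReal_volume_circle : (volume : Measure UnitAddCircle).real Set.univ = 1 := by
  rw [measureReal_def, UnitAddCircle.measure_univ, ENNReal.toReal_one]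

theorem volume_singleton_circle (t : UnitAddCircle) : volume ({t} : Set UnitAddCircle) = 0 := by
  rw [← Metric.closedBall_zero, AddCircle.volume_closedBall]
  simp

theorem zsmul_ne_zero_of_irrational {β : ℝ} (hβ : Irrational β) {n : ℤ} (hn : n ≠ 0) :
    n • (β : UnitAddCircle) ≠ 0 := by
  intro h
  rw [← AddCircle.coe_zsmul, AddCircle.coe_eq_zero_iff] at h
  obtain ⟨m, hm⟩ := h
  have hm' : (m : ℝ) = n * β := by simpa using hm
  exact (hβ.intCast_mul hn) ⟨m, by exact_mod_cast hm'⟩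

/-- Birkhoff averages converge uniformly to the mean. -/
def UniformlyEquidistributed (β : ℝ) (g : C(UnitAddCircle, ℂ)) : Prop :=
  ∀ ε > 0, ∃ m₀ : ℕ, ∀ m ≥ m₀, ∀ θ : UnitAddCircle,
    ‖(∑ i ∈ Finset.range m, g (θ + i • (β : UnitAddCircle))) - m * ∫ t, g t‖ ≤ ε * m

theorem integrable_continuousMap (g : C(UnitAddCircle, ℂ)) : Integrable (fun t => g t) :=
  g.continuous.integrable_of_hasCompactSupport (HasCompactSupport.of_compactSpace _)

/-- For `n ≠ 0` the sum is geometric with ratio `c ≠ 1`, hence bounded; `θ` enters only through a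
unimodular factor, which gives uniformity. -/
theorem uniformlyEquidistributed_fourier {β : ℝ} (hβ : Irrational β) (n : ℤ) :
    UniformlyEquidistributed β (fourier n) := by
  intro ε hε
  rcases eq_or_ne n 0 with rfl | hn
  · refine ⟨0, fun m _ θ => ?_⟩
    have : ∀ t : UnitAddCircle, (fourier 0 : C(UnitAddCircle, ℂ)) t = 1 := fun t => fourier_zero
    simp only [this]
    simp only [Finset.sum_const, Finset.card_range, nsmul_eq_mul, mul_one, integral_const,
      measureReal_volume_circle, one_smul, sub_self, norm_zero]
    positivity
  · set c : ℂ := (fourier n : C(UnitAddCircle, ℂ)) (β : UnitAddCircle)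
    have hadd : ∀ s t : UnitAddCircle, (fourier n : C(UnitAddCircle, ℂ)) (s + t) =
        (fourier n : C(UnitAddCircle, ℂ)) s * (fourier n : C(UnitAddCircle, ℂ)) t := by
      intro s t
      simp only [fourier_apply, smul_add, AddCircle.toCircle_add, Circle.coe_mul]
    have hc : c ≠ 1 := by
      intro h
      have h1 : AddCircle.toCircle (n • (β : UnitAddCircle)) =
          AddCircle.toCircle (0 : UnitAddCircle) := by
        rw [AddCircle.toCircle_zero]
        exact Circle.ext (by simpa [c, fourier_apply] using h)
      exact zsmul_ne_zero_of_irrational hβ hn (AddCircle.injective_toCircle one_ne_zero h1)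
    have hint : ∫ t, (fourier n : C(UnitAddCircle, ℂ)) t = 0 := by
      have h := integral_add_right_eq_self (μ := (volume : Measure UnitAddCircle))
        (fun t => (fourier n : C(UnitAddCircle, ℂ)) t) (β : UnitAddCircle)
      simp only [hadd] at h
      rw [integral_mul_const] at h
      have h2 : (∫ t, (fourier n : C(UnitAddCircle, ℂ)) t) * (c - 1) = 0 := by
        rw [mul_sub, mul_one]; exact sub_eq_zero.2 h
      exact (mul_eq_zero.1 h2).resolve_right (sub_ne_zero.2 hc)
    have hpow : ∀ i : ℕ, (fourier n : C(UnitAddCircle, ℂ)) (i • (β : UnitAddCircle)) = c ^ i := by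
      intro i
      induction i with
      | zero => simp
      | succ i ih => rw [succ_nsmul, hadd, ih, pow_succ]
    have hnorm : ∀ t : UnitAddCircle, ‖(fourier n : C(UnitAddCircle, ℂ)) t‖ = 1 :=
      fun t => Circle.norm_coe _
    have hc0 : 0 < ‖c - 1‖ := norm_pos_iff.2 (sub_ne_zero.2 hc)
    obtain ⟨m₀, hm₀⟩ := exists_nat_ge (2 / ‖c - 1‖ / ε)
    refine ⟨m₀, fun m hm θ => ?_⟩
    simp only [hint, mul_zero, sub_zero, hadd, hpow]
    rw [← Finset.mul_sum, norm_mul, hnorm, one_mul, geom_sum_eq hc, norm_div]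
    have h1 : ‖c ^ m - 1‖ ≤ 2 := by
      refine (norm_sub_le _ _).trans ?_
      rw [norm_pow, hnorm, one_pow, norm_one]; norm_num
    calc ‖c ^ m - 1‖ / ‖c - 1‖ ≤ 2 / ‖c - 1‖ := by gcongr
      _ ≤ m₀ * ε := (div_le_iff₀ hε).1 hm₀
      _ ≤ ε * m := by rw [mul_comm]; gcongr

theorem UniformlyEquidistributed.add {β : ℝ} {g h : C(UnitAddCircle, ℂ)}
    (hg : UniformlyEquidistributed β g) (hh : UniformlyEquidistributed β h) :
    UniformlyEquidistributed β (g + h) := by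
  intro ε hε
  obtain ⟨m₁, h₁⟩ := hg (ε / 2) (by positivity)
  obtain ⟨m₂, h₂⟩ := hh (ε / 2) (by positivity)
  refine ⟨max m₁ m₂, fun m hm θ => ?_⟩
  have a1 := h₁ m ((le_max_left _ _).trans hm) θ
  have a2 := h₂ m ((le_max_right _ _).trans hm) θ
  simp only [ContinuousMap.add_apply]
  rw [Finset.sum_add_distrib, integral_add (integrable_continuousMap g)
    (integrable_continuousMap h)]
  refine le_trans (le_of_eq ?_) ((norm_add_le _ _).trans ((add_le_add a1 a2).trans (le_of_eq ?_)))
  · congr 1; ring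
  · ring

theorem UniformlyEquidistributed.smul {β : ℝ} {g : C(UnitAddCircle, ℂ)}
    (hg : UniformlyEquidistributed β g) (a : ℂ) : UniformlyEquidistributed β (a • g) := by
  intro ε hε
  obtain ⟨m₁, h₁⟩ := hg (ε / (‖a‖ + 1)) (by positivity)
  refine ⟨m₁, fun m hm θ => ?_⟩
  have a1 := h₁ m hm θ
  simp only [ContinuousMap.smul_apply, smul_eq_mul]
  rw [← Finset.mul_sum, integral_const_mul]
  calc _ = ‖a‖ * ‖(∑ i ∈ Finset.range m, g (θ + i • (β : UnitAddCircle))) - m * ∫ t, g t‖ := by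
        rw [← norm_mul]; congr 1; ring
    _ ≤ (‖a‖ + 1) * (ε / (‖a‖ + 1) * m) := by gcongr; linarith
    _ = ε * m := by field_simp

/-- Weyl's argument: the property passes from characters to trigonometric polynomials, and then to
uniform limits. -/
theorem uniformlyEquidistributed {β : ℝ} (hβ : Irrational β) (g : C(UnitAddCircle, ℂ)) :
    UniformlyEquidistributed β g := by
  have hspan : ∀ h ∈ Submodule.span ℂ (Set.range (@fourier 1)), UniformlyEquidistributed β h := by
    intro h hh
    induction hh using Submodule.span_induction with
    | mem x hx => obtain ⟨n, rfl⟩ := hx; exact uniformlyEquidistributed_fourier hβ n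
    | zero => intro ε hε; exact ⟨0, fun m _ θ => by simpa using by positivity⟩
    | add x y _ _ hx hy => exact hx.add hy
    | smul a x _ hx => exact hx.smul a
  have hg : g ∈ closure (Submodule.span ℂ (Set.range (@fourier 1)) : Set C(UnitAddCircle, ℂ)) := by
    rw [← Submodule.topologicalClosure_coe, span_fourier_closure_eq_top]
    trivial
  intro ε hε
  obtain ⟨h, hh, hgh⟩ := Metric.mem_closure_iff.1 hg (ε / 3) (by positivity)
  obtain ⟨m₀, hm₀⟩ := hspan h hh (ε / 3) (by positivity)
  refine ⟨m₀, fun m hm θ => ?_⟩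
  rw [dist_eq_norm] at hgh
  have hpt : ∀ t, ‖g t - h t‖ ≤ ε / 3 := fun t =>
    (ContinuousMap.norm_coe_le_norm (g - h) t).trans hgh.le
  have e1 : ‖∑ i ∈ Finset.range m, (g (θ + i • (β : UnitAddCircle)) -
      h (θ + i • (β : UnitAddCircle)))‖ ≤ m * (ε / 3) := by
    refine (norm_sum_le_of_le _ fun i _ => hpt _).trans ?_
    simp
  have e2 : ‖∫ t, (h t - g t)‖ ≤ ε / 3 := by
    have := norm_integral_le_of_norm_le_const (μ := (volume : Measure UnitAddCircle))
      (f := fun t => h t - g t) (C := ε / 3)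
      (ae_of_all _ fun t => by rw [norm_sub_rev]; exact hpt t)
    simpa [measureReal_volume_circle] using this
  rw [integral_sub (integrable_continuousMap h) (integrable_continuousMap g)] at e2
  have e3 : ‖(m : ℂ) * ((∫ t, h t) - ∫ t, g t)‖ ≤ m * (ε / 3) := by
    rw [norm_mul, Complex.norm_natCast]; gcongr
  have e4 := hm₀ m hm θ
  rw [Finset.sum_sub_distrib] at e1
  calc _ = ‖((∑ i ∈ Finset.range m, g (θ + i • (β : UnitAddCircle))) -
        ∑ i ∈ Finset.range m, h (θ + i • (β : UnitAddCircle))) +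
        ((∑ i ∈ Finset.range m, h (θ + i • (β : UnitAddCircle))) - m * ∫ t, h t) +
        (m : ℂ) * ((∫ t, h t) - ∫ t, g t)‖ := by congr 1; ring
    _ ≤ m * (ε / 3) + ε / 3 * m + m * (ε / 3) :=
      (norm_add₃_le).trans (by gcongr)
    _ = ε * m := by ring

theorem exists_sum_rotation_le {β : ℝ} (hβ : Irrational β) {g : UnitAddCircle → ℝ}
    (hg : Continuous g) {ε : ℝ} (hε : 0 < ε) :
    ∃ m₀ : ℕ, ∀ m ≥ m₀, ∀ θ : UnitAddCircle,
      ∑ i ∈ Finset.range m, g (θ + i • (β : UnitAddCircle)) ≤ m * ((∫ t, g t) + ε) := by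
  obtain ⟨m₀, h⟩ := uniformlyEquidistributed hβ
    ⟨fun t => (g t : ℂ), Complex.continuous_ofReal.comp hg⟩ ε hε
  refine ⟨m₀, fun m hm θ => ?_⟩
  have h1 := h m hm θ
  simp only [ContinuousMap.coe_mk] at h1
  rw [integral_complex_ofReal] at h1
  have h2 : ‖(((∑ i ∈ Finset.range m, g (θ + i • (β : UnitAddCircle))) -
      m * ∫ t, g t : ℝ) : ℂ)‖ ≤ ε * m := by
    push_cast; exact h1
  rw [Complex.norm_real, Real.norm_eq_abs] at h2
  linarith [le_abs_self ((∑ i ∈ Finset.range m, g (θ + i • (β : UnitAddCircle))) -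
      m * ∫ t, g t)]

/-! ### Continuous majorants -/

/-- A bounded function that is continuous off a finite set has continuous majorants with almost
the same mean. -/
theorem exists_continuous_majorant {φ : UnitAddCircle → ℝ} {M : ℝ} (hφ : ∀ t, |φ t| ≤ M)
    {D : Set UnitAddCircle} (hD : D.Finite) (hc : ∀ t ∉ D, ContinuousAt φ t) {ε : ℝ}
    (hε : 0 < ε) :
    ∃ g : UnitAddCircle → ℝ, Continuous g ∧ (∀ t, φ t ≤ g t) ∧ ∫ t, g t < (∫ t, φ t) + ε := by
  -- Sup-convolution: `g n` is `n`-Lipschitz, lies above `φ`, and tends to `φ` wherever `φ` is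
  -- continuous.
  set g : ℕ → UnitAddCircle → ℝ := fun n t => ⨆ s, (φ s - n * dist t s)
  have hub : ∀ (n : ℕ) t s, φ s - n * dist t s ≤ M := fun n t s => by
    have := (abs_le.1 (hφ s)).2
    have : 0 ≤ (n : ℝ) * dist t s := by positivity
    linarith
  have hbdd : ∀ (n : ℕ) t, BddAbove (Set.range fun s => φ s - n * dist t s) := fun n t =>
    ⟨M, by rintro _ ⟨s, rfl⟩; exact hub n t s⟩
  have hle : ∀ n t, φ t ≤ g n t := fun n t => by
    refine le_trans ?_ (le_ciSup (hbdd n t) t)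
    simp
  have hleM : ∀ n t, g n t ≤ M := fun n t => ciSup_le (hub n t)
  have hlip : ∀ n : ℕ, LipschitzWith n (g n) := fun n => by
    refine LipschitzWith.of_le_add_mul _ fun x y => ciSup_le fun s => ?_
    have h1 := le_ciSup (hbdd n y) s
    have h2 := dist_triangle y x s
    rw [dist_comm y x] at h2
    have h3 : (n : ℝ) * dist y s ≤ n * (dist x y + dist x s) := by gcongr
    change _ ≤ g n y at h1
    simp only [NNReal.coe_natCast]
    linarith
  have hlim : ∀ t ∉ D, Tendsto (fun n => g n t) atTop (𝓝 (φ t)) := by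
    intro t ht
    rw [Metric.tendsto_atTop]
    intro η hη
    obtain ⟨r, hr, hball⟩ := Metric.continuousAt_iff.1 (hc t ht) (η / 2) (by positivity)
    -- Beyond distance `r` the penalty is at least `2M`, so distant points cannot exceed `φ t`.
    obtain ⟨N, hN⟩ := exists_nat_ge (2 * M / r)
    refine ⟨N, fun n hn => ?_⟩
    have hgn : g n t ≤ φ t + η / 2 := by
      refine ciSup_le fun s => ?_
      rcases lt_or_ge (dist s t) r with hs | hs
      · have := hball hs
        rw [Real.dist_eq] at this
        have h1 := (abs_lt.1 this).2
        have : 0 ≤ (n : ℝ) * dist t s := by positivity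
        linarith
      · have h1 : 2 * M ≤ n * dist t s := by
          rw [dist_comm t s]
          calc 2 * M ≤ N * r := (div_le_iff₀ hr).1 hN
            _ ≤ n * dist s t := by gcongr
        have h2 := (abs_le.1 (hφ s)).2
        have h3 := (abs_le.1 (hφ t)).1
        linarith
    rw [Real.dist_eq, abs_lt]
    constructor <;> linarith [hle n t]
  have hae : ∀ᵐ t : UnitAddCircle, Tendsto (fun n => g n t) atTop (𝓝 (φ t)) := by
    have h0 : (volume : Measure UnitAddCircle) D = 0 := by
      rw [← Set.biUnion_of_singleton D]
      exact (measure_biUnion_null_iff hD.countable).2 fun t _ => volume_singleton_circle t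
    filter_upwards [measure_eq_zero_iff_ae_notMem.1 h0] with t ht using hlim t ht
  have hI := tendsto_integral_of_dominated_convergence (μ := (volume : Measure UnitAddCircle))
    (F := g) (f := φ) (fun _ => M)
    (fun n => (hlip n).continuous.aestronglyMeasurable) (integrable_const M)
    (fun n => ae_of_all _ fun t => by
      rw [Real.norm_eq_abs, abs_le]
      exact ⟨(abs_le.1 (hφ t)).1.trans (hle n t), hleM n t⟩) hae
  obtain ⟨n, hn⟩ := ((tendsto_order.1 hI).2 _ (by linarith : (∫ t, φ t) < (∫ t, φ t) + ε)).exists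
  exact ⟨g n, (hlip n).continuous, hle n, hn⟩

/-! ### Piecewise Hölder functions -/

theorem exists_bound_of_mem_PL {γ : ℝ} {f : UnitAddCircle → ℝ} (hf : f ∈ PL γ) :
    ∃ M : ℝ, 0 ≤ M ∧ (∀ t, |f t| ≤ M) ∧ ∀ (h : ℝ), 0 < h → ∀ t : UnitAddCircle,
      ENNReal.ofReal h < Metric.infEDist t (discontinuities f) →
        |f (t + (h : UnitAddCircle)) - f t| ≤ M * h ^ γ := by
  have hfin := hf.2.ne
  refine ⟨(plNorm γ f).toReal, ENNReal.toReal_nonneg, fun t => ?_, fun h hh t ht => ?_⟩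
  · rw [← ENNReal.ofReal_le_iff_le_toReal hfin]
    exact (le_iSup (fun t => ENNReal.ofReal |f t|) t).trans le_self_add
  · rw [← div_le_iff₀ (Real.rpow_pos_of_pos hh γ), ← ENNReal.ofReal_le_iff_le_toReal hfin]
    refine le_trans ?_ le_add_self
    exact le_iSup_of_le h (le_iSup_of_le hh (le_iSup_of_le t (le_iSup_of_le ht le_rfl)))

/-! ### The uniform upper bound -/

section

variable (ω : ℝ) (f : UnitAddCircle → ℝ)

theorem continuousAt_transferMatrix (z : ℂ) {θ : UnitAddCircle} (h : ContinuousAt f θ) :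
    ContinuousAt (transferMatrix f z) θ := by
  rw [ContinuousAt, tendsto_iff_norm_sub_tendsto_zero]
  have h1 : Tendsto (fun t => |f t - f θ|) (𝓝 θ) (𝓝 0) := by
    have := tendsto_iff_norm_sub_tendsto_zero.1 h
    simpa [Real.norm_eq_abs] using this
  refine squeeze_zero (fun _ => norm_nonneg _) (fun t => ?_) h1
  simpa using norm_transferMatrix_sub f z z t θ

theorem continuousAt_forwardCocycle (z : ℂ) (n : ℕ) {θ : UnitAddCircle}
    (h : ∀ i < n, ContinuousAt f (θ + i • (ω : UnitAddCircle))) :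
    ContinuousAt (forwardCocycle ω f z n) θ := by
  induction n with
  | zero => exact continuousAt_const
  | succ n ih =>
    have h1 := continuousAt_transferMatrix f z (h n n.lt_succ_self)
    have h2 : ContinuousAt (fun t : UnitAddCircle => t + n • (ω : UnitAddCircle)) θ :=
      (continuous_id.add continuous_const).continuousAt
    have h3 : ContinuousAt
        (fun t => transferMatrix f z (t + n • (ω : UnitAddCircle))) θ :=
      ContinuousAt.comp (f := fun t : UnitAddCircle => t + n • (ω : UnitAddCircle)) h1 h2
    exact h3.mul (ih fun i hi => h i (hi.trans n.lt_succ_self))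

theorem norm_forwardCocycle_le_pow {z : ℂ} {R : ℝ} (hR : ∀ θ, ‖transferMatrix f z θ‖ ≤ R)
    (j : ℕ) (θ : UnitAddCircle) : ‖forwardCocycle ω f z j θ‖ ≤ R ^ j := by
  induction j with
  | zero => simp [forwardCocycle]
  | succ j ih =>
    rw [forwardCocycle, pow_succ']
    refine (norm_mul_le _ _).trans ?_
    have := (norm_nonneg _).trans (hR 0)
    gcongr
    exact hR _

theorem lyapunov_nonneg (z : ℂ) : 0 ≤ lyapunov ω f z := by
  refine Real.iInf_nonneg fun k => mul_nonneg (by positivity) (integral_nonneg fun θ => ?_)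
  rw [cocycle_natCast]
  exact Real.log_nonneg (one_le_norm_forwardCocycle ω f z _ θ)

theorem lyapunov_le (z : ℂ) {k : ℕ} (hk : 1 ≤ k) :
    lyapunov ω f z ≤ (1 / (k : ℝ)) * ∫ θ : UnitAddCircle, Real.log ‖forwardCocycle ω f z k θ‖ := by
  have hb : BddBelow (Set.range fun k : {k : ℕ // 1 ≤ k} =>
      (1 / (k : ℝ)) * ∫ θ : UnitAddCircle, Real.log ‖cocycle ω f z ((k : ℕ) : ℤ) θ‖) := by
    refine ⟨0, ?_⟩
    rintro _ ⟨k, rfl⟩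
    refine mul_nonneg (by positivity) (integral_nonneg fun θ => ?_)
    rw [cocycle_natCast]
    exact Real.log_nonneg (one_le_norm_forwardCocycle ω f z _ θ)
  refine (ciInf_le hb ⟨k, hk⟩).trans (le_of_eq ?_)
  simp only [cocycle_natCast]

theorem exists_integral_lt_lyapunov_add (z : ℂ) {ε : ℝ} (hε : 0 < ε) :
    ∃ N : ℕ, 1 ≤ N ∧ (1 / (N : ℝ)) *
      ∫ θ : UnitAddCircle, Real.log ‖forwardCocycle ω f z N θ‖ < lyapunov ω f z + ε := by
  have : Nonempty {k : ℕ // 1 ≤ k} := ⟨⟨1, le_rfl⟩⟩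
  obtain ⟨⟨N, hN⟩, h⟩ := exists_lt_of_ciInf_lt
    (show lyapunov ω f z < lyapunov ω f z + ε by linarith)
  exact ⟨N, hN, by simpa only [cocycle_natCast] using h⟩

variable {ω f}

theorem finite_iUnion_discontinuities (hD : (discontinuities f).Finite) (N : ℕ) :
    {θ : UnitAddCircle | ∃ i < N, θ + i • (ω : UnitAddCircle) ∈ discontinuities f}.Finite := by
  have : {θ : UnitAddCircle | ∃ i < N, θ + i • (ω : UnitAddCircle) ∈ discontinuities f} ⊆
      ⋃ i ∈ Finset.range N, (fun θ : UnitAddCircle => θ + i • (ω : UnitAddCircle)) ⁻¹'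
        discontinuities f := by
    rintro θ ⟨i, hi, h⟩
    simp only [Set.mem_iUnion]
    exact ⟨i, Finset.mem_range.2 hi, h⟩
  refine Set.Finite.subset (Set.Finite.biUnion (Finset.finite_toSet _) fun i _ => ?_) this
  exact hD.preimage (add_left_injective _).injOn

theorem exists_transferMatrix_bound {M : ℝ} (hM : ∀ t, |f t| ≤ M) (E : ℂ) :
    ∃ R : ℝ, 1 ≤ R ∧ ∀ z : ℂ, ‖z - E‖ ≤ 1 → ∀ θ, ‖transferMatrix f z θ‖ ≤ R := by
  refine ⟨‖transferMatrix f E 0‖ + (1 + 2 * M), ?_, fun z hz θ => ?_⟩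
  · have := one_le_norm_of_det_eq_one (transferMatrix_det f E 0)
    have := (abs_nonneg _).trans (hM 0)
    linarith
  · have h1 := norm_transferMatrix_sub f z E θ 0
    have h2 := norm_le_insert' (transferMatrix f z θ) (transferMatrix f E 0)
    have h3 := abs_sub (f θ) (f 0)
    linarith [hM θ, hM 0]

/-- `N` is fixed before `z` moves, so a small disc of energies changes `A_N` by at most `N ε`. As
`‖A_N‖ ≥ 1`, this additive error is a factor at most `1 + N ε ≤ e^{N ε}`. -/
theorem exists_majorant_near {M : ℝ} (hM : ∀ t, |f t| ≤ M)
    (hD : (discontinuities f).Finite) (E : ℂ) {ε : ℝ} (hε : 0 < ε) :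
    ∃ N : ℕ, 1 ≤ N ∧ ∃ g : UnitAddCircle → ℝ, Continuous g ∧
      ∫ t, g t < lyapunov ω f E + ε ∧ ∃ r : ℝ, 0 < r ∧ ∀ z : ℂ, ‖z - E‖ ≤ r → ∀ θ,
        ‖forwardCocycle ω f z N θ‖ ≤ Real.exp (N * (g θ + ε)) := by
  obtain ⟨R, hR1, hR⟩ := exists_transferMatrix_bound hM E
  have hR0 : 0 < R := by linarith
  obtain ⟨N, hN, hNL⟩ := exists_integral_lt_lyapunov_add ω f E (half_pos hε)
  have hNr : (0 : ℝ) < N := by exact_mod_cast hN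
  have hone := one_le_norm_forwardCocycle ω f E N
  have hRE : ∀ θ, ‖forwardCocycle ω f E N θ‖ ≤ R ^ N :=
    norm_forwardCocycle_le_pow ω f (hR E (by simp)) N
  obtain ⟨g, hg, hle, hint⟩ := exists_continuous_majorant
    (φ := fun θ => 1 / (N : ℝ) * Real.log ‖forwardCocycle ω f E N θ‖)
    (M := 1 / (N : ℝ) * Real.log (R ^ N))
    (fun θ => by
      rw [abs_of_nonneg (mul_nonneg (by positivity) (Real.log_nonneg (hone θ)))]
      gcongr
      · exact zero_lt_one.trans_le (hone θ)
      · exact hRE θ)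
    (finite_iUnion_discontinuities (ω := ω) hD N)
    (fun θ hθ => by
      refine ContinuousAt.mul continuousAt_const (ContinuousAt.log ?_ (by linarith [hone θ]))
      refine (continuousAt_forwardCocycle ω f E N fun i hi => ?_).norm
      by_contra hc
      exact hθ ⟨i, hi, hc⟩) (half_pos hε)
  rw [integral_const_mul] at hint
  refine ⟨N, hN, g, hg, by linarith, min 1 (ε / R ^ N), by positivity, fun z hz θ => ?_⟩
  have hz1 := hz.trans (min_le_left _ _)
  have hz2 := hz.trans (min_le_right _ _)
  have hexp : ∀ j : ℕ, 1 * Real.exp (Real.log R * j) = R ^ j := fun j => by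
    rw [one_mul, mul_comm, Real.exp_nat_mul, Real.exp_log hR0]
  have hd := norm_forwardCocycle_sub_le ω f (B := 1) (lam := Real.log R) (η := ‖z - E‖)
    (norm_nonneg _) zero_le_one (z := z) (z' := E)
    (fun j t => by rw [hexp]; exact norm_forwardCocycle_le_pow ω f (hR z hz1) j t)
    (fun j t => by rw [hexp]; exact norm_forwardCocycle_le_pow ω f (hR E (by simp)) j t)
    (Real.log_nonneg hR1) N θ θ (fun i _ => by simp)
  rw [one_pow, hexp] at hd
  have hd2 : ‖forwardCocycle ω f z N θ - forwardCocycle ω f E N θ‖ ≤ N * ε := by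
    refine hd.trans ?_
    gcongr
    rw [mul_comm]
    exact (le_div_iff₀ (by positivity)).1 hz2
  have hgθ : Real.log ‖forwardCocycle ω f E N θ‖ ≤ N * g θ := by
    have := hle θ
    rw [one_div, inv_mul_le_iff₀ hNr] at this
    exact this
  have hE : ‖forwardCocycle ω f E N θ‖ ≤ Real.exp (N * g θ) :=
    (Real.log_le_iff_le_exp (by linarith [hone θ])).1 hgθ
  calc ‖forwardCocycle ω f z N θ‖
      ≤ ‖forwardCocycle ω f E N θ‖ + N * ε := by
        linarith [norm_le_insert' (forwardCocycle ω f z N θ) (forwardCocycle ω f E N θ)]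
    _ ≤ ‖forwardCocycle ω f E N θ‖ * (N * ε + 1) := by
        nlinarith [mul_nonneg (sub_nonneg.2 (hone θ)) (by positivity : 0 ≤ N * ε)]
    _ ≤ Real.exp (N * g θ) * Real.exp (N * ε) := by
        gcongr
        exact Real.add_one_le_exp _
    _ = _ := by rw [← Real.exp_add, mul_add]

/-- Cutting into blocks of length `N` turns the bound into a Birkhoff sum over the rotation by `N
ω`, which is again irrational when `N ≥ 1` and `ω` is irrational. -/
theorem norm_forwardCocycle_mul_le {z : ℂ} {N : ℕ} {G : UnitAddCircle → ℝ}
    (h : ∀ θ, ‖forwardCocycle ω f z N θ‖ ≤ Real.exp (G θ)) (m : ℕ) (θ : UnitAddCircle) :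
    ‖forwardCocycle ω f z (m * N) θ‖ ≤
      Real.exp (∑ i ∈ Finset.range m, G (θ + i • ((N * ω : ℝ) : UnitAddCircle))) := by
  induction m with
  | zero => simp [forwardCocycle]
  | succ m ih =>
    have e : (m + 1) * N = N + m * N := by ring
    rw [e, forwardCocycle_add, Finset.sum_range_succ, add_comm (Finset.sum _ _), Real.exp_add]
    refine (norm_mul_le _ _).trans ?_
    gcongr
    rw [← nsmul_eq_mul N ω, AddCircle.coe_nsmul, ← mul_smul]
    exact h _

/-- Uniform upper semicontinuity of the Lyapunov exponent. -/
theorem exists_norm_forwardCocycle_le (hω : Irrational ω) {M : ℝ} (hM : ∀ t, |f t| ≤ M)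
    (hD : (discontinuities f).Finite) (E : ℂ) {ε : ℝ} (hε : 0 < ε) :
    ∃ r : ℝ, 0 < r ∧ ∃ C : ℝ, 1 ≤ C ∧ ∀ z : ℂ, ‖z - E‖ ≤ r → ∀ (j : ℕ) (θ : UnitAddCircle),
      ‖forwardCocycle ω f z j θ‖ ≤ C * Real.exp ((lyapunov ω f E + ε) * j) := by
  obtain ⟨R, hR1, hR⟩ := exists_transferMatrix_bound hM E
  obtain ⟨N, hN, g, hg, hint, r, hr, hrN⟩ :=
    exists_majorant_near (ω := ω) hM hD E (by positivity : 0 < ε / 3)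
  have hirr : Irrational (N * ω) := hω.natCast_mul (by omega)
  obtain ⟨m₀, hm₀⟩ := exists_sum_rotation_le hirr hg (by positivity : 0 < ε / 3)
  have hL := lyapunov_nonneg ω f E
  set Λ := lyapunov ω f E
  -- `R ^ N` pays for the incomplete last block, `R ^ (m₀ * N)` for having too few blocks to
  -- equidistribute.
  refine ⟨min 1 r, by positivity, R ^ N * R ^ (m₀ * N),
    one_le_mul_of_one_le_of_one_le (one_le_pow₀ hR1) (one_le_pow₀ hR1), fun z hz j θ => ?_⟩
  have hz1 := hR z (hz.trans (min_le_left _ _))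
  have hz2 := hrN z (hz.trans (min_le_right _ _))
  have hblock : ∀ m θ, ‖forwardCocycle ω f z (m * N) θ‖ ≤
      R ^ (m₀ * N) * Real.exp ((Λ + ε) * (m * N : ℕ)) := by
    intro m θ
    rcases lt_or_ge m m₀ with hm | hm
    · calc _ ≤ R ^ (m * N) := norm_forwardCocycle_le_pow ω f hz1 _ _
        _ ≤ R ^ (m₀ * N) * 1 := by
          rw [mul_one]
          exact pow_le_pow_right₀ hR1 (by gcongr)
        _ ≤ _ := by
          gcongr
          exact Real.one_le_exp (by positivity)
    · refine (norm_forwardCocycle_mul_le hz2 m θ).trans ?_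
      rw [← one_mul (Real.exp _)]
      gcongr
      · exact one_le_pow₀ hR1
      · have hs := hm₀ m hm θ
        rw [← Finset.mul_sum, Finset.sum_add_distrib, Finset.sum_const, Finset.card_range,
          nsmul_eq_mul]
        push_cast
        calc _ ≤ (N : ℝ) * (m * ((∫ t, g t) + ε / 3) + m * (ε / 3)) := by gcongr
          _ ≤ (N : ℝ) * (m * ((Λ + ε / 3) + ε / 3) + m * (ε / 3)) := by gcongr
          _ = _ := by ring
  have hj : j = j % N + j / N * N := by rw [mul_comm]; exact (Nat.mod_add_div j N).symm
  conv_lhs => rw [hj]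
  rw [forwardCocycle_add]
  refine (norm_mul_le _ _).trans ?_
  have h1 : ‖forwardCocycle ω f z (j % N) (θ + (j / N * N) • (ω : UnitAddCircle))‖ ≤ R ^ N :=
    (norm_forwardCocycle_le_pow ω f hz1 _ _).trans
      (pow_le_pow_right₀ hR1 (Nat.mod_lt j hN).le)
  rw [mul_assoc]
  refine mul_le_mul h1 ((hblock (j / N) θ).trans ?_) (norm_nonneg _) (by positivity)
  gcongr
  exact Nat.div_mul_le_self j N

/-- The upper bound is uniform on compact sets on which the Lyapunov exponent is continuous. -/
theorem exists_norm_forwardCocycle_le_of_isCompact (hω : Irrational ω) {M : ℝ}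
    (hM : ∀ t, |f t| ≤ M) (hD : (discontinuities f).Finite) {S : Set ℝ} (hS : IsCompact S)
    (hc : ContinuousOn (fun E : ℝ => lyapunov ω f (E : ℂ)) S) {ε : ℝ} (hε : 0 < ε) :
    ∃ r : ℝ, 0 < r ∧ ∃ C : ℝ, 1 ≤ C ∧ ∀ E ∈ S, ∀ z : ℂ, ‖z - E‖ ≤ r →
      ∀ (j : ℕ) (θ : UnitAddCircle),
        ‖forwardCocycle ω f z j θ‖ ≤ C * Real.exp ((lyapunov ω f E + ε) * j) := by
  refine hS.induction_on (p := fun s => ∃ r : ℝ, 0 < r ∧ ∃ C : ℝ, 1 ≤ C ∧ ∀ E ∈ s, ∀ z : ℂ,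
      ‖z - (E : ℝ)‖ ≤ r → ∀ (j : ℕ) (θ : UnitAddCircle),
        ‖forwardCocycle ω f z j θ‖ ≤ C * Real.exp ((lyapunov ω f E + ε) * j))
    ⟨1, one_pos, 1, le_rfl, by simp⟩ ?_ ?_ ?_
  · rintro s t hst ⟨r, hr, C, hC, h⟩
    exact ⟨r, hr, C, hC, fun E hE => h E (hst hE)⟩
  · rintro s t ⟨r, hr, C, hC, h⟩ ⟨r', hr', C', hC', h'⟩
    refine ⟨min r r', lt_min hr hr', max C C', hC.trans (le_max_left _ _), ?_⟩
    rintro E (hE | hE) z hz j θ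
    · refine (h E hE z (hz.trans (min_le_left _ _)) j θ).trans ?_
      gcongr
      exact le_max_left _ _
    · refine (h' E hE z (hz.trans (min_le_right _ _)) j θ).trans ?_
      gcongr
      exact le_max_right _ _
  · intro E₀ hE₀
    obtain ⟨r, hr, C, hC, h⟩ := exists_norm_forwardCocycle_le hω hM hD (E₀ : ℂ) (half_pos hε)
    -- Only lower semicontinuity is used: it lets the rate `𝓛(E₀) + ε/2` be replaced by `𝓛(E) + ε`.
    refine ⟨{E | |E - E₀| < r / 2 ∧ lyapunov ω f (E₀ : ℂ) - ε / 2 < lyapunov ω f (E : ℂ)},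
      ?_, r / 2, by positivity, C, hC, ?_⟩
    · refine Filter.inter_mem (mem_nhdsWithin_of_mem_nhds ?_)
        ((hc E₀ hE₀).eventually_const_lt (by linarith))
      exact Metric.ball_mem_nhds E₀ (half_pos hr)
    · rintro E ⟨hE1, hE2⟩ z hz j θ
      have h1 : ‖z - (E₀ : ℂ)‖ ≤ r := by
        have : z - (E₀ : ℂ) = (z - (E : ℂ)) + ((E - E₀ : ℝ) : ℂ) := by push_cast; ring
        rw [this]
        refine (norm_add_le _ _).trans ?_
        rw [Complex.norm_real, Real.norm_eq_abs]
        linarith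
      have h2 : lyapunov ω f (E₀ : ℂ) + ε / 2 ≤ lyapunov ω f (E : ℂ) + ε := by linarith
      refine (h z h1 j θ).trans ?_
      gcongr

end

/-! ### Growth on a short interval -/

section

variable {ω : ℝ} {f : UnitAddCircle → ℝ}

theorem ofReal_lt_infEDist {J : Set UnitAddCircle} (hJ : J.Finite) {t : UnitAddCircle} {h : ℝ}
    (hh : 0 ≤ h) (ht : ∀ d ∈ J, h < dist t d) : ENNReal.ofReal h < Metric.infEDist t J := by
  rcases J.eq_empty_or_nonempty with rfl | hne
  · simp
  · obtain ⟨d, hd, he⟩ := hJ.isCompact.exists_infEDist_eq_edist hne t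
    rw [he, edist_dist]
    exact (ENNReal.ofReal_lt_ofReal_iff (hh.trans_lt (ht d hd))).2 (ht d hd)

/-- At every scale some point far from the discontinuities has almost maximal growth. -/
theorem exists_far_norm_ge {J : Finset UnitAddCircle} {k : ℕ} (hk : 1 ≤ k) {ε C h : ℝ} {E : ℂ}
    (hε : 0 < ε) (hC : 1 ≤ C)
    (hup : ∀ θ, ‖forwardCocycle ω f E k θ‖ ≤ C * Real.exp ((lyapunov ω f E + ε) * k))
    (hlog : Real.log C ≤ ε * k) (hmeas : k * J.card * (2 * h) ≤ 1 / 4) :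
    ∃ θ₀ : UnitAddCircle, (∀ i < k, ∀ d ∈ J, h < dist (θ₀ + i • (ω : UnitAddCircle)) d) ∧
      Real.exp ((lyapunov ω f E - ε) * k) ≤ ‖forwardCocycle ω f E k θ₀‖ := by
  by_contra! hcon
  have hkr : (0 : ℝ) < k := by exact_mod_cast hk
  -- The starting points whose orbit comes within `h` of `J` before time `k`.
  set B : Set UnitAddCircle := ⋃ i ∈ Finset.range k, ⋃ d ∈ J,
    Metric.closedBall (d - i • (ω : UnitAddCircle)) h
  have hBm : MeasurableSet B :=
    Finset.measurableSet_biUnion _ fun i _ => Finset.measurableSet_biUnion _ fun d _ =>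
      Metric.isClosed_closedBall.measurableSet
  have hBμ : (volume : Measure UnitAddCircle) B ≤ ENNReal.ofReal (1 / 4) := by
    calc volume B ≤ ∑ i ∈ Finset.range k, ∑ d ∈ J,
          volume (Metric.closedBall (d - i • (ω : UnitAddCircle)) h) :=
          (measure_biUnion_finset_le _ _).trans
            (Finset.sum_le_sum fun i _ => measure_biUnion_finset_le _ _)
      _ ≤ ∑ i ∈ Finset.range k, ∑ d ∈ J, ENNReal.ofReal (2 * h) := by
          gcongr
          rw [AddCircle.volume_closedBall]
          exact ENNReal.ofReal_le_ofReal (min_le_right _ _)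
      _ = ENNReal.ofReal (k * J.card * (2 * h)) := by
          rw [Finset.sum_const, Finset.sum_const, Finset.card_range, smul_smul, nsmul_eq_mul,
            ← Nat.cast_mul, ENNReal.ofReal_mul (p := ((k * J.card : ℕ) : ℝ)) (by positivity),
            ENNReal.ofReal_natCast]
      _ ≤ _ := ENNReal.ofReal_le_ofReal hmeas
  have hBr : (volume : Measure UnitAddCircle).real B ≤ 1 / 4 :=
    ENNReal.toReal_le_of_le_ofReal (by norm_num) hBμ
  set Λ := lyapunov ω f E with hΛ
  -- Off `B` the logarithm is below `(Λ-ε)k` by contradiction; on `B` it is at most `(Λ+2ε)k`, with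
  -- `ln C` absorbed in `εk`. As `B` has measure at most `1/4`, the mean is at most `(Λ-ε/4)k`, less
  -- than `Λk`.
  set u : UnitAddCircle → ℝ := fun θ => (Λ - ε) * k + B.indicator (fun _ => 3 * ε * k) θ
  have hI : Integrable (B.indicator (fun _ => 3 * ε * k) : UnitAddCircle → ℝ) :=
    (integrable_const _).indicator hBm
  have hu : Integrable u := (integrable_const _).add hI
  have hone := one_le_norm_forwardCocycle ω f E k
  have hle : ∀ θ, Real.log ‖forwardCocycle ω f E k θ‖ ≤ u θ := by
    intro θ
    have hpos : 0 < ‖forwardCocycle ω f E k θ‖ := by linarith [hone θ]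
    by_cases hθ : θ ∈ B
    · have h1 := Real.log_le_log hpos (hup θ)
      rw [Real.log_mul (by positivity) (Real.exp_pos _).ne', Real.log_exp] at h1
      simp only [u, Set.indicator_of_mem hθ]
      linarith
    · have h1 := hcon θ fun i hi d hd => by
        by_contra! hc
        refine hθ (Set.mem_biUnion (Finset.mem_coe.2 (Finset.mem_range.2 hi))
          (Set.mem_biUnion (Finset.mem_coe.2 hd) ?_))
        rw [Metric.mem_closedBall]
        rwa [← dist_add_right _ _ (i • (ω : UnitAddCircle)), sub_add_cancel]
      have h2 := (Real.log_lt_iff_lt_exp hpos).2 h1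
      simp only [u, Set.indicator_of_notMem hθ]
      linarith
  have hint : ∫ θ, Real.log ‖forwardCocycle ω f E k θ‖ ≤ ∫ θ, u θ :=
    integral_mono_of_nonneg (ae_of_all _ fun θ => Real.log_nonneg (hone θ)) hu
      (ae_of_all _ hle)
  have hu2 : ∫ θ, u θ = (Λ - ε) * k + (volume : Measure UnitAddCircle).real B * (3 * ε * k) := by
    rw [integral_add (integrable_const _) hI, integral_indicator_const _ hBm]
    simp [measureReal_volume_circle]
  have hL := lyapunov_le ω f E hk
  rw [one_div, le_inv_mul_iff₀ hkr, ← hΛ] at hL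
  have h3 : (volume : Measure UnitAddCircle).real B * (3 * ε * k) ≤ 1 / 4 * (3 * ε * k) := by
    gcongr
  have : 0 < ε * k := by positivity
  nlinarith

/-- On a short interval, and for all nearby energies, the cocycle is large. -/
theorem exists_interval_norm_ge {γ M : ℝ} (hγ : 0 < γ) (hM : 0 ≤ M)
    (hD : (discontinuities f).Finite)
    (hf : ∀ (h : ℝ), 0 < h → ∀ t : UnitAddCircle,
      ENNReal.ofReal h < Metric.infEDist t (discontinuities f) →
        |f (t + (h : UnitAddCircle)) - f t| ≤ M * h ^ γ)
    {k : ℕ} (hk : 1 ≤ k) {ε C h r τ : ℝ} {E : ℂ}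
    (hε : 0 < ε) (hC : 1 ≤ C) (hh : 0 < h) (hr : 0 < r) (hτ : 0 ≤ τ) (hτr : τ ≤ r)
    (hup : ∀ z : ℂ, ‖z - E‖ ≤ r → ∀ (j : ℕ) (θ : UnitAddCircle),
      ‖forwardCocycle ω f z j θ‖ ≤ C * Real.exp ((lyapunov ω f E + ε) * j))
    (hlog : Real.log C ≤ ε * k) (hmeas : k * hD.toFinset.card * (2 * h) ≤ 1 / 4)
    (hpert : k * C ^ 2 * Real.exp (2 * ε * k) * (τ + M * h ^ γ) ≤ 1 / 2) :
    ∃ θ₀ : UnitAddCircle, ∀ s : ℝ, 0 < s → s < h → ∀ z : ℂ, ‖z - E‖ ≤ τ →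
      Real.exp ((lyapunov ω f E - ε) * k) / 2 ≤
        ‖forwardCocycle ω f z k (θ₀ + (s : UnitAddCircle))‖ := by
  obtain ⟨θ₀, hfar, hθ₀⟩ := exists_far_norm_ge hk hε hC (hup E (by simpa using hr.le) k)
    hlog hmeas
  refine ⟨θ₀, fun s hs hsh z hz => ?_⟩
  have hL := lyapunov_nonneg ω f E
  have hd := norm_forwardCocycle_sub_le ω f (B := C) (lam := lyapunov ω f E + ε)
    (η := τ + M * h ^ γ) (by positivity) (by linarith) (z := z) (z' := E)
    (hup z (hz.trans hτr)) (hup E (by simpa using hr.le)) (by positivity) k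
    (θ₀ + (s : UnitAddCircle)) θ₀ (fun i hi => by
      have h1 := hf s hs (θ₀ + i • (ω : UnitAddCircle))
        (ofReal_lt_infEDist hD hs.le fun d hd => hsh.trans (hfar i hi d (hD.mem_toFinset.2 hd)))
      rw [add_right_comm] at h1
      have h2 : M * s ^ γ ≤ M * h ^ γ := by gcongr
      linarith)
  -- The upper and lower growth bounds differ by `e^{2εk}`; this is the whole relative cost of
  -- perturbing.
  have e : Real.exp ((lyapunov ω f E + ε) * k) =
      Real.exp (2 * ε * k) * Real.exp ((lyapunov ω f E - ε) * k) := by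
    rw [← Real.exp_add]; congr 1; ring
  have hd2 : ‖forwardCocycle ω f z k (θ₀ + (s : UnitAddCircle)) - forwardCocycle ω f E k θ₀‖ ≤
      1 / 2 * Real.exp ((lyapunov ω f E - ε) * k) := by
    refine hd.trans (le_trans (le_of_eq ?_)
      (mul_le_mul_of_nonneg_right hpert (Real.exp_pos _).le))
    rw [e]; ring
  have h3 := norm_sub_norm_le (forwardCocycle ω f E k θ₀)
    (forwardCocycle ω f z k (θ₀ + (s : UnitAddCircle)))
  rw [norm_sub_rev] at h3
  linarith

/-! ### From growth on an interval to the lower bound for `Phi` -/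

theorem le_iSup_div_of_le {X Y : ℝ} (hX : 0 < X) {a : ℕ → ℝ} {j : ℕ} (h1 : 1 ≤ j)
    (hj : (j : ℝ) ≤ Y) (h : X ≤ a j) :
    1 ≤ (⨆ j : {j : ℕ // 1 ≤ j ∧ (j : ℝ) ≤ Y}, a j) / X := by
  rw [one_le_div hX]
  -- Finiteness is essential: a real supremum of an unbounded family would default to 0.
  have hfin : Finite {j : ℕ // 1 ≤ j ∧ (j : ℝ) ≤ Y} := by
    refine Set.Finite.to_subtype ((Set.finite_Iic ⌊Y⌋₊).subset fun i hi => ?_)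
    exact Nat.le_floor hi.2
  exact h.trans (le_ciSup (f := fun j : {j : ℕ // 1 ≤ j ∧ (j : ℝ) ≤ Y} => a j)
    (Set.finite_range _).bddAbove ⟨j, h1, hj⟩)

theorem le_sq_or_le_sq_of_le_mul {X a b : ℝ} (ha : 0 ≤ a) (hb : 0 ≤ b) (h : X ≤ a * b) :
    X ≤ a ^ 2 ∨ X ≤ b ^ 2 := by
  rcases le_total a b with hab | hab
  · right; nlinarith
  · left; nlinarith

/-- The constant 27 is set by negative times: one factor 3 for splitting the product and one for
each of the two inverses. -/
theorem one_le_Phi {ζ δ T D : ℝ} {E : ℂ} (hT : 0 < T) {p : ℤ} {q k : ℕ} (hq : 1 ≤ q)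
    (hpq : IsCoprime p (q : ℤ)) (hω : |ω - p / q| ≤ 1 / (q : ℝ) ^ 2)
    (hqk : (q : ℝ) + k ≤ T ^ ζ) (hD : 27 * T ^ δ ≤ D) {θ₀ : UnitAddCircle}
    (hbig : ∀ s : ℝ, 0 < s → s < 3 / q → ∀ z : ℂ, ‖z - E‖ ≤ T ^ (-ζ) →
      D ≤ ‖forwardCocycle ω f z k (θ₀ + (s : UnitAddCircle))‖) :
    1 ≤ Phi ω f ζ δ E T := by
  have hX : 0 < T ^ δ := Real.rpow_pos_of_pos hT δ
  have : Nonempty ({z : ℂ // ‖z - E‖ ≤ T ^ (-ζ)} × UnitAddCircle) :=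
    ⟨⟨E, by simpa using (Real.rpow_pos_of_pos hT _).le⟩, 0⟩
  refine le_ciInf ?_
  rintro ⟨⟨z, hz⟩, θ⟩
  refine le_min ?_ ?_
  -- Starting from `θ + ω` makes the entry time `j + 1` at least 1, as the maximum over `j`
  -- requires.
  · obtain ⟨j, hj, s, hs, hsq, he⟩ :=
      exists_lt_add_smul_eq hq hpq hω (θ + (ω : UnitAddCircle)) θ₀
    have he' : θ + (j + 1) • (ω : UnitAddCircle) = θ₀ + (s : UnitAddCircle) := by
      rw [← he, add_smul, one_smul]; abel
    have h1 := norm_forwardCocycle_le_left ω f z k (j + 1) θ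
    rw [he'] at h1
    have h2 := hbig s hs hsq z hz
    have hjr : ((j + 1 : ℕ) : ℝ) ≤ q := by exact_mod_cast hj
    have hk0 : (0 : ℝ) ≤ k := k.cast_nonneg
    rcases le_sq_or_le_sq_of_le_mul (norm_nonneg _) (norm_nonneg _)
      (show T ^ δ ≤ ‖forwardCocycle ω f z (k + (j + 1)) θ‖ * ‖forwardCocycle ω f z (j + 1) θ‖ by
        linarith) with h | h
    · refine le_iSup_div_of_le hX (a := fun j => ‖cocycle ω f z (j : ℤ) θ‖ ^ 2)
        (j := k + (j + 1)) (by omega) ?_ (by rw [cocycle_natCast]; exact h)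
      rw [Nat.cast_add]; linarith
    · refine le_iSup_div_of_le hX (a := fun j => ‖cocycle ω f z (j : ℤ) θ‖ ^ 2)
        (j := j + 1) (by omega) ?_ (by rw [cocycle_natCast]; exact h)
      linarith
  -- Starting `k + q` steps back leaves, after entry, `k` steps on the large block and then `m + 1 ≥
  -- 1` more to reach `θ`.
  · obtain ⟨j, hj, s, hs, hsq, he⟩ :=
      exists_lt_add_smul_eq hq hpq hω (θ - (k + q) • (ω : UnitAddCircle)) θ₀
    obtain ⟨m, rfl⟩ := Nat.exists_eq_add_of_lt hj
    have he1 : θ - ((m + 1) + k) • (ω : UnitAddCircle) = θ₀ + (s : UnitAddCircle) := by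
      rw [← he]
      simp only [add_smul, one_smul]
      abel
    have he2 : θ - ((m + 1) + k) • (ω : UnitAddCircle) + k • (ω : UnitAddCircle) =
        θ - (m + 1) • (ω : UnitAddCircle) := by
      rw [add_smul]; abel
    have h1 := norm_forwardCocycle_le_right ω f z (m + 1) k
      (θ - ((m + 1) + k) • (ω : UnitAddCircle))
    rw [he2] at h1
    have h2 := hbig s hs hsq z hz
    rw [← he1] at h2
    have h3 := norm_cocycle_neg_le ω f z (m + 1) θ
    have h4 := norm_cocycle_neg_le ω f z (m + 1 + k) θ
    have h5 : ‖forwardCocycle ω f z (m + 1) (θ - (m + 1) • (ω : UnitAddCircle))‖ *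
        ‖forwardCocycle ω f z (m + 1 + k) (θ - (m + 1 + k) • (ω : UnitAddCircle))‖ ≤
        3 * ‖cocycle ω f z (-((m + 1 : ℕ) : ℤ)) θ‖ *
          (3 * ‖cocycle ω f z (-((m + 1 + k : ℕ) : ℤ)) θ‖) := by gcongr
    push_cast at hqk
    have hj0 : (0 : ℝ) ≤ j := j.cast_nonneg
    have hk0 : (0 : ℝ) ≤ k := k.cast_nonneg
    rcases le_sq_or_le_sq_of_le_mul (norm_nonneg _) (norm_nonneg _)
      (show T ^ δ ≤ ‖cocycle ω f z (-((m + 1 : ℕ) : ℤ)) θ‖ *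
          ‖cocycle ω f z (-((m + 1 + k : ℕ) : ℤ)) θ‖ by linarith) with h | h
    · refine le_iSup_div_of_le hX (a := fun j => ‖cocycle ω f z (-(j : ℤ)) θ‖ ^ 2)
        (j := m + 1) (by omega) ?_ h
      push_cast; linarith
    · refine le_iSup_div_of_le hX (a := fun j => ‖cocycle ω f z (-(j : ℤ)) θ‖ ^ 2)
        (j := m + 1 + k) (by omega) ?_ h
      push_cast; linarith

/-! ### Choice of scales -/

theorem eventually_mul_rpow_neg_le {s η : ℝ} (hs : 0 < s) (hη : 0 < η) (A : ℝ) :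
    ∀ᶠ T : ℝ in atTop, A * T ^ (-s) ≤ η := by
  have h := (tendsto_rpow_neg_atTop hs).const_mul A
  rw [mul_zero] at h
  exact (h.eventually_lt_const hη).mono fun _ h => h.le

/-- With `k = ⌈K ln T⌉`, the growth `e^{χk/2} ≥ T^(δ+1)` beats `54 T^δ`, where 54 is 27 times the
factor 2 lost in perturbation. The errors are powers of `T`: with `σ = min ζ (bγ)`, `k ≤ T^(σ/4)`,
`e^{2εk}` is of order at most `T^(σ/2)`, and the perturbation is of order `T^(-σ)`. The choice of
`k` precedes that of `q`. -/
theorem eventually_scales {ζ γ a δ χ M ε C r K : ℝ} (n : ℕ) (hζ : 0 < ζ) (hγ : 0 < γ)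
    (ha : 1 ≤ a) (hM : 0 ≤ M) (hε : 0 < ε) (hC : 1 ≤ C) (hr : 0 < r)
    (hK : 0 < K) (hKχ : χ / 2 * K = δ + 1) (hχ : 0 < χ)
    (hεK : 2 * ε * K ≤ min ζ (ζ / a * γ) / 2) :
    ∀ᶠ T : ℝ in atTop, 1 ≤ T ∧ ∃ k : ℕ, ∀ q : ℕ, T ^ ζ ≤ 2 * (q : ℝ) ^ a →
      1 ≤ k ∧ k ≤ q ∧ Real.log C ≤ ε * k ∧ k * n * (2 * (3 / (q : ℝ))) ≤ 1 / 4 ∧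
      k * C ^ 2 * Real.exp (2 * ε * k) * (T ^ (-ζ) + M * (3 / (q : ℝ)) ^ γ) ≤ 1 / 2 ∧
      54 * T ^ δ ≤ Real.exp (χ / 2 * k) ∧ T ^ (-ζ) ≤ r := by
  set b := ζ / a
  have hb : 0 < b := by positivity
  set σ := min ζ (b * γ)
  have hσ : 0 < σ := lt_min hζ (by positivity)
  have hlogK : ∀ s : ℝ, 0 < s → ∀ᶠ T : ℝ in atTop, K * Real.log T + 1 ≤ T ^ s := by
    intro s hs
    have h1 := (isLittleO_log_rpow_atTop hs).def (show 0 < 1 / (2 * K) by positivity)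
    filter_upwards [h1, (tendsto_rpow_atTop hs).eventually_ge_atTop 2, eventually_ge_atTop 1]
      with T h1 h2 h3
    rw [Real.norm_eq_abs, Real.norm_eq_abs, abs_of_nonneg (Real.log_nonneg h3),
      abs_of_nonneg (by positivity)] at h1
    have h4 : K * Real.log T ≤ K * (1 / (2 * K) * T ^ s) := by gcongr
    have h5 : K * (1 / (2 * K) * T ^ s) = T ^ s / 2 := by field_simp
    linarith
  set A := C ^ 2 * Real.exp (2 * ε) * (1 + M * 6 ^ γ)
  filter_upwards [hlogK (b / 2) (by positivity), hlogK (σ / 4) (by positivity),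
    eventually_mul_rpow_neg_le (show 0 < b / 2 by positivity) one_pos 2,
    eventually_mul_rpow_neg_le (show 0 < b / 2 by positivity) (show (0 : ℝ) < 1 / 4 by norm_num)
      (12 * n),
    eventually_mul_rpow_neg_le (show 0 < σ / 4 by positivity) (show (0 : ℝ) < 1 / 2 by norm_num) A,
    eventually_mul_rpow_neg_le hζ hr 1, eventually_ge_atTop 54,
    (Real.tendsto_log_atTop.const_mul_atTop (mul_pos hε hK)).eventually_ge_atTop (Real.log C)]
    with T h1 h2 h3 h4 h5 h6 h7 h8
  have hT1 : 1 ≤ T := by linarith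
  have hT0 : 0 < T := by linarith
  have hlogT : 0 < Real.log T := Real.log_pos (by linarith)
  have hk1 := Nat.le_ceil (K * Real.log T)
  have hk2 := Nat.ceil_lt_add_one (show 0 ≤ K * Real.log T by positivity)
  refine ⟨hT1, ⌈K * Real.log T⌉₊, fun q hq => ?_⟩
  have hkpos : 1 ≤ ⌈K * Real.log T⌉₊ := Nat.ceil_pos.2 (by positivity)
  set k := ⌈K * Real.log T⌉₊
  -- Otherwise `q^a < T^ζ / 2^a ≤ T^ζ / 2`; the last inequality needs `a ≥ 1`.
  have hqb : T ^ b / 2 ≤ q := by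
    by_contra! hlt
    have e1 : (q : ℝ) ^ a < (T ^ b / 2) ^ a :=
      Real.rpow_lt_rpow (by positivity) hlt (by linarith)
    have e2 : (T ^ b / 2) ^ a = T ^ ζ / 2 ^ a := by
      rw [Real.div_rpow (by positivity) (by norm_num), ← Real.rpow_mul hT0.le,
        div_mul_cancel₀ _ (by linarith)]
    have e3 : (2 : ℝ) ≤ 2 ^ a := by
      calc (2 : ℝ) = 2 ^ (1 : ℝ) := (Real.rpow_one 2).symm
        _ ≤ 2 ^ a := Real.rpow_le_rpow_of_exponent_le (by norm_num) ha
    have e4 : T ^ ζ / 2 ^ a ≤ T ^ ζ / 2 := by gcongr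
    linarith
  have hTb : 0 < T ^ b := by positivity
  have hq0 : (0 : ℝ) < q := by linarith
  have hbsplit : T ^ (b / 2) = T ^ b * T ^ (-(b / 2)) := by
    rw [← Real.rpow_add hT0]; congr 1; ring
  have h3q : 3 / (q : ℝ) ≤ 6 * T ^ (-b) := by
    rw [Real.rpow_neg hT0.le, div_le_iff₀ hq0]
    calc (3 : ℝ) = 6 * (T ^ b)⁻¹ * (T ^ b / 2) := by field_simp; norm_num
      _ ≤ _ := by gcongr
  refine ⟨hkpos, ?_, ?_, ?_, ?_, ?_, by linarith⟩
  · have : (k : ℝ) ≤ q := by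
      have : T ^ b * (2 * T ^ (-(b / 2))) ≤ T ^ b * 1 := by gcongr
      linarith
    exact_mod_cast this
  · have : ε * (K * Real.log T) ≤ ε * k := by gcongr
    linarith
  · calc (k : ℝ) * n * (2 * (3 / (q : ℝ))) ≤ T ^ (b / 2) * n * (2 * (6 * T ^ (-b))) := by
          gcongr; linarith
      _ = 12 * n * (T ^ (b / 2) * T ^ (-b)) := by ring
      _ = 12 * n * T ^ (-(b / 2)) := by rw [← Real.rpow_add hT0]; congr 2; ring
      _ ≤ _ := h4
  · have e1 : Real.exp (2 * ε * k) ≤ Real.exp (2 * ε) * T ^ (σ / 2) := by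
      calc Real.exp (2 * ε * k) ≤ Real.exp (2 * ε + Real.log T * (2 * ε * K)) := by
            gcongr
            nlinarith
        _ = Real.exp (2 * ε) * T ^ (2 * ε * K) := by
            rw [Real.exp_add, Real.rpow_def_of_pos hT0]
        _ ≤ _ := by gcongr
    have e2 : T ^ (-ζ) ≤ T ^ (-σ) :=
      Real.rpow_le_rpow_of_exponent_le hT1 (neg_le_neg (min_le_left _ _))
    have e3 : (3 / (q : ℝ)) ^ γ ≤ 6 ^ γ * T ^ (-σ) := by
      calc (3 / (q : ℝ)) ^ γ ≤ (6 * T ^ (-b)) ^ γ := by gcongr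
        _ = 6 ^ γ * T ^ (-b * γ) := by
            rw [Real.mul_rpow (by norm_num) (by positivity), ← Real.rpow_mul hT0.le]
        _ ≤ _ := by
            gcongr
            rw [neg_mul]; exact neg_le_neg (min_le_right _ _)
    calc k * C ^ 2 * Real.exp (2 * ε * k) * (T ^ (-ζ) + M * (3 / (q : ℝ)) ^ γ)
        ≤ T ^ (σ / 4) * C ^ 2 * (Real.exp (2 * ε) * T ^ (σ / 2)) *
          (T ^ (-σ) + M * (6 ^ γ * T ^ (-σ))) := by
          gcongr; linarith
      _ = A * (T ^ (σ / 4) * T ^ (σ / 2) * T ^ (-σ)) := by simp only [A]; ring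
      _ = A * T ^ (-(σ / 4)) := by
          rw [← Real.rpow_add hT0, ← Real.rpow_add hT0]; congr 2; ring
      _ ≤ _ := h5
  · calc 54 * T ^ δ ≤ T * T ^ δ := by gcongr
      _ = T ^ (δ + 1) := by rw [Real.rpow_add_one hT0.ne']; ring
      _ = Real.exp (χ / 2 * (K * Real.log T)) := by
          rw [← hKχ, Real.rpow_def_of_pos hT0]; congr 1; ring
      _ ≤ _ := by gcongr

/-- The lower bound at all large times at which some denominator has the right size. -/
theorem exists_forall_one_le_Phi (hω : Irrational ω) {γ : ℝ} (hγ : 0 < γ) (hf : f ∈ PL γ)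
    {χ : ℝ} (hχ : 0 < χ) {S : Set ℝ} (hS : IsCompact S)
    (hc : ContinuousOn (fun E : ℝ => lyapunov ω f (E : ℂ)) S)
    (hL : ∀ E ∈ S, χ < lyapunov ω f (E : ℂ)) {δ ζ a : ℝ} (hδ : 1 ≤ δ) (hζ : 0 < ζ)
    (ha : 1 ≤ a) :
    ∃ T₀ : ℝ, ∀ T > T₀, ∀ (p : ℤ) (q : ℕ), 1 ≤ q → IsCoprime p (q : ℤ) →
      |ω - p / q| ≤ 1 / (q : ℝ) ^ 2 → 2 * q ≤ T ^ ζ → T ^ ζ ≤ 2 * (q : ℝ) ^ a →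
        ∀ E ∈ S, 1 ≤ Phi ω f ζ δ (E : ℂ) T := by
  obtain ⟨M, hM0, hM, hH⟩ := exists_bound_of_mem_PL hf
  set K := 2 * (δ + 1) / χ
  have hK : 0 < K := by positivity
  set σ := min ζ (ζ / a * γ)
  have hσ : 0 < σ := lt_min hζ (by positivity)
  -- The first term keeps the growth rate above `χ/2`; the second keeps `e^{2εk}` of order at most
  -- `T^(σ/2)`.
  set ε := min (χ / 2) (σ / (4 * K))
  have hε : 0 < ε := by positivity
  obtain ⟨r, hr, C, hC, hup⟩ :=
    exists_norm_forwardCocycle_le_of_isCompact hω hM hf.1 hS hc hε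
  have hev := eventually_scales (δ := δ) (χ := χ) hf.1.toFinset.card hζ hγ ha hM0 hε hC hr hK
    (by simp only [K]; field_simp) hχ (by
      calc 2 * ε * K ≤ 2 * (σ / (4 * K)) * K := by gcongr; exact min_le_right _ _
        _ = σ / 2 := by field_simp; norm_num)
  obtain ⟨T₀, hT₀⟩ := eventually_atTop.1 hev
  refine ⟨T₀, fun T hT p q hq hpq hω' hq1 hq2 E hE => ?_⟩
  obtain ⟨hT1, k, hk⟩ := hT₀ T hT.le
  obtain ⟨hk1, hkq, hlog, hmeas, hpert, hbig, hTr⟩ := hk q hq2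
  have hT0 : 0 < T := by linarith
  have hq0 : (0 : ℝ) < q := by exact_mod_cast hq
  obtain ⟨θ₀, hθ₀⟩ := exists_interval_norm_ge (ω := ω) hγ hM0 hf.1 hH hk1 hε hC
    (show 0 < 3 / (q : ℝ) by positivity) hr (by positivity) hTr (hup E hE) hlog hmeas hpert
  have hkq' : (k : ℝ) ≤ q := by exact_mod_cast hkq
  refine one_le_Phi hT0 hq hpq hω' (k := k) (by linarith) ?_ hθ₀
  have h1 : χ / 2 ≤ lyapunov ω f (E : ℂ) - ε := by
    linarith [hL E hE, min_le_left (χ / 2) (σ / (4 * K))]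
  have h2 : Real.exp (χ / 2 * k) ≤ Real.exp ((lyapunov ω f (E : ℂ) - ε) * k) := by gcongr
  linarith

/-! ### The two families of times -/

theorem exists_times (hω : Irrational ω) {ζ : ℝ} (hζ : 0 < ζ) :
    ∃ T : ℕ → ℝ, Tendsto T atTop atTop ∧ ∀ n, ∃ (p : ℤ) (q : ℕ), 1 ≤ q ∧ IsCoprime p (q : ℤ) ∧
      |ω - p / q| ≤ 1 / (q : ℝ) ^ 2 ∧ 2 * q ≤ T n ^ ζ ∧ T n ^ ζ ≤ 2 * (q : ℝ) ^ (1 : ℝ) := by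
  refine ⟨fun n => (2 * (GenContFract.of ω).dens n) ^ ζ⁻¹,
    (tendsto_rpow_atTop (inv_pos.2 hζ)).comp ((tendsto_dens hω).const_mul_atTop two_pos),
    fun n => ?_⟩
  obtain ⟨p, q, hq, hqd, hpq, hpω⟩ := exists_coprime_convergent hω n
  have e : ((2 * (GenContFract.of ω).dens n) ^ ζ⁻¹) ^ ζ = 2 * q := by
    rw [← hqd, ← Real.rpow_mul (by positivity), inv_mul_cancel₀ hζ.ne', Real.rpow_one]
  exact ⟨p, q, hq, hpq, hpω, e.ge, by rw [e, Real.rpow_one]⟩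

/-- Take the last denominator with `2 q_n ≤ T^ζ`. Then `T^ζ < 2 q_{n+1} < 2 q_n^(1+κ)`, so `a = 1 +
κ` works. -/
theorem exists_denominator_of_diophantine (hω : Irrational ω) (hD : Diophantine ω) {ζ : ℝ}
    (hζ : 0 < ζ) :
    ∃ a : ℝ, 1 ≤ a ∧ ∃ T₁ : ℝ, ∀ T > T₁, ∃ (p : ℤ) (q : ℕ), 1 ≤ q ∧ IsCoprime p (q : ℤ) ∧
      |ω - p / q| ≤ 1 / (q : ℝ) ^ 2 ∧ 2 * q ≤ T ^ ζ ∧ T ^ ζ ≤ 2 * (q : ℝ) ^ a := by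
  obtain ⟨κ, hκ, hev⟩ := hD
  obtain ⟨N, hN⟩ := eventually_atTop.1 hev
  set d := (GenContFract.of ω).dens
  have hmono : Monotone d := monotone_nat_of_le_succ fun n => GenContFract.of_den_mono
  obtain ⟨T₁, hT₁⟩ := eventually_atTop.1
    ((tendsto_rpow_atTop hζ).eventually_ge_atTop (2 * d N))
  refine ⟨1 + κ, by linarith, T₁, fun T hT => ?_⟩
  have h1 : 2 * d N ≤ T ^ ζ := hT₁ T hT.le
  have hex : ∃ n, T ^ ζ < 2 * d n :=
    (((tendsto_dens hω).const_mul_atTop two_pos).eventually_gt_atTop (T ^ ζ)).exists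
  classical
  have hlt := Nat.find_spec hex
  -- This makes the predecessor index at least `N`, where the Diophantine inequality is available.
  have hNlt : N < Nat.find hex := by
    by_contra! hle
    have := hmono hle
    linarith
  obtain ⟨n, hn⟩ := Nat.exists_eq_succ_of_ne_zero (by omega : Nat.find hex ≠ 0)
  have hmin : 2 * d n ≤ T ^ ζ := not_lt.1 (Nat.find_min hex (by omega : n < Nat.find hex))
  rw [hn] at hlt
  have hdio := hN n (by omega)
  obtain ⟨p, q, hq, hqd, hpq, hpω⟩ := exists_coprime_convergent hω n
  refine ⟨p, q, hq, hpq, hpω, by rw [hqd]; exact hmin, ?_⟩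
  rw [hqd]
  have : d (n + 1) < d n ^ (1 + κ) := hdio
  have h2 : T ^ ζ < 2 * d (n + 1) := hlt
  linarith

end

end QPCocycle

theorem mainTheorem5 (ω : ℝ) (hω : Irrational ω) (γ : ℝ) (hγ : 0 < γ)
    (f : UnitAddCircle → ℝ) (hf : f ∈ QPCocycle.PL γ)
    (χ : ℝ) (hχ : 0 < χ) (U : Set ℝ) (hU : MeasurableSet U)
    (hL : ∀ E ∈ U, χ < QPCocycle.lyapunov ω f (E : ℂ))
    (δ : ℝ) (hδ : 1 ≤ δ) (ζ : ℝ) (hζ : 0 < ζ) (hζ' : ζ ≤ 1) :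
    ∃ c : ℝ, 0 < c ∧ ∃ T : ℕ → ℝ, Filter.Tendsto T Filter.atTop Filter.atTop ∧
      (∀ E ∈ U, ∃ nE : ℕ, ∀ n : ℕ, nE < n → c < QPCocycle.Phi ω f ζ δ (E : ℂ) (T n)) ∧
      (QPCocycle.Diophantine ω →
        ∀ E ∈ U, ∃ TE : ℝ, ∀ t : ℝ, TE < t → c < QPCocycle.Phi ω f ζ δ (E : ℂ) t) ∧
      (IsCompact U → ContinuousOn (fun E : ℝ => QPCocycle.lyapunov ω f (E : ℂ)) U →
        (∃ n₀ : ℕ, ∀ E ∈ U, ∀ n : ℕ, n₀ < n → c < QPCocycle.Phi ω f ζ δ (E : ℂ) (T n)) ∧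
        (QPCocycle.Diophantine ω →
          ∃ T₀ : ℝ, ∀ E ∈ U, ∀ t : ℝ, T₀ < t →
            c < QPCocycle.Phi ω f ζ δ (E : ℂ) t)) := by
  obtain ⟨T, hT, hTn⟩ := QPCocycle.exists_times hω hζ
  -- The times are fixed before `S`, so the pointwise and the uniform statements share one sequence.
  have hseq : ∀ S ⊆ U, IsCompact S →
      ContinuousOn (fun E : ℝ => QPCocycle.lyapunov ω f (E : ℂ)) S →
      ∃ n₀ : ℕ, ∀ E ∈ S, ∀ n : ℕ, n₀ < n → 1 / 2 < QPCocycle.Phi ω f ζ δ (E : ℂ) (T n) := by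
    intro S hSU hS hc
    obtain ⟨T₀, hT₀⟩ := QPCocycle.exists_forall_one_le_Phi hω hγ hf hχ hS hc
      (fun E hE => hL E (hSU hE)) hδ hζ le_rfl
    obtain ⟨n₀, hn₀⟩ := Filter.eventually_atTop.1 (hT.eventually_gt_atTop T₀)
    refine ⟨n₀, fun E hE n hn => ?_⟩
    obtain ⟨p, q, hq, hpq, hpω, h1, h2⟩ := hTn n
    linarith [hT₀ (T n) (hn₀ n hn.le) p q hq hpq hpω h1 h2 E hE]
  have hall : QPCocycle.Diophantine ω → ∀ S ⊆ U, IsCompact S →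
      ContinuousOn (fun E : ℝ => QPCocycle.lyapunov ω f (E : ℂ)) S →
      ∃ T₀ : ℝ, ∀ E ∈ S, ∀ t : ℝ, T₀ < t → 1 / 2 < QPCocycle.Phi ω f ζ δ (E : ℂ) t := by
    intro hD S hSU hS hc
    obtain ⟨a, ha, T₁, hT₁⟩ := QPCocycle.exists_denominator_of_diophantine hω hD hζ
    obtain ⟨T₀, hT₀⟩ := QPCocycle.exists_forall_one_le_Phi hω hγ hf hχ hS hc
      (fun E hE => hL E (hSU hE)) hδ hζ ha
    refine ⟨max T₀ T₁, fun E hE t ht => ?_⟩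
    obtain ⟨p, q, hq, hpq, hpω, h1, h2⟩ := hT₁ t ((le_max_right _ _).trans_lt ht)
    linarith [hT₀ t ((le_max_left _ _).trans_lt ht) p q hq hpq hpω h1 h2 E hE]
  refine ⟨1 / 2, by norm_num, T, hT, fun E hE => ?_, fun hD E hE => ?_, fun hU hc =>
    ⟨hseq U subset_rfl hU hc, fun hD => hall hD U subset_rfl hU hc⟩⟩
  -- A singleton is compact and every function is continuous on it, so no regularity of `𝓛` is
  -- needed.
  · obtain ⟨n₀, h⟩ := hseq {E} (Set.singleton_subset_iff.2 hE) isCompact_singleton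
      (continuousOn_singleton _ _)
    exact ⟨n₀, h E rfl⟩
  · obtain ⟨T₀, h⟩ := hall hD {E} (Set.singleton_subset_iff.2 hE) isCompact_singleton
      (continuousOn_singleton _ _)
    exact ⟨T₀, h E rfl⟩
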